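/- Let $P\in\mathbb Z[z]$ be a polynomial of degree $d$ with an integer root $\rho$ of multiplicity $1$, and write $P(z+\rho)=\beta_d z^d+\cdots+\beta_1 z$, where $\beta_1,\beta_d\neq 0$; assume $\beta_d\beta_1^{d}>0$. For real $w>10$ let $W=\prod_{p<w}p$ be the product of the primes below $w$, let $$\widetilde P(z)=\frac{P(\beta_1Wz+\rho)}{\beta_1^2W}=\beta_d\beta_1^{d-2}W^{d-1}z^d+\cdots+\beta_2Wz^2+z\in\mathbb Z[z],$$ and let $W_d=\beta_d\beta_1^{d-2}W^{d-1}>0$ be its leading coefficient. For real $K$ write $[K]=\{z\in\mathbb Z:0\le z\le K-1\}$, and let $e(x)=e^{2\pi i x}$. For a positive integer $N$ and $z\in\mathbb Z$ put $$\tilde\nu(z)=\frac{N}{(N/W_d)^{1/d}}\,1_{\widetilde P([(N/W_d)^{1/d}])}(z),\qquad \nu(z)=d^{-1}\,1_{[N]}(z)\,\Bigl(\frac{N}{z+1}\Bigr)^{(d-1)/d},\qquad \nu^*=\tilde\nu-\nu .$$ Proposition F.1. For every $C_1>0$ there exist $C_2>0$, $c>0$ and $K_0>0$, depending only on $C_1$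 and $P$ (with its chosen root $\rho$), such that the following holds for every real $w>10$, with $W$ as above. If $V\le W^{C_1}$ is a nonnegative integer power of $W$ and $N\ge W^{C_2}$ is an integer, then $$\max_{r\in[V]}\ \max_{\theta\in\mathbb R/\mathbb Z}\ \Bigl|\sum_{z\in\mathbb Z}e(\theta z)\,\nu^*(Vz+r)\Bigr|\le K_0\,\frac{N}{V\,w^{c}} .$$ -/

import Mathlib

namespace NuUniformity

open Polynomial

noncomputable section

/-- The additive character `e(x) = exp(2πix)`. It is `1`-periodic, so for integers `z` the
number `e(θz)` depends only on the class of the real number `θ` in `ℝ/ℤ`. -/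
def e (x : ℝ) : ℂ := Complex.exp (2 * Real.pi * Complex.I * x)

/-- The discrete interval `[K] = {z ∈ ℤ : 0 ≤ z ≤ K - 1}` for a real number `K`. -/
def interval (K : ℝ) : Set ℤ := {z | 0 ≤ z ∧ (z : ℝ) ≤ K - 1}

/-- `W`, the product of all primes `p < w`. -/
def primorialBelow (w : ℝ) : ℕ := ∏ p ∈ Finset.range ⌈w⌉₊ with p.Prime, p

/-- The coefficient `β_i` in the expansion `P(z + ρ) = β_d z^d + ⋯ + β_1 z` at the root `ρ`. -/
def beta (P : ℤ[X]) (ρ : ℤ) (i : ℕ) : ℤ := (P.comp (X + C ρ)).coeff i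

/-- The `W`-tricked polynomial
`P̃(z) = β_d β_1^(d-2) W^(d-1) z^d + β_(d-1) β_1^(d-3) W^(d-2) z^(d-1) + ⋯ + β_2 W z^2 + z`,
where `d` is the degree of `P`. -/
def tricked (P : ℤ[X]) (ρ : ℤ) (W : ℕ) : ℤ[X] :=
  X + ∑ i ∈ Finset.Icc 2 P.natDegree,
    C (beta P ρ i * beta P ρ 1 ^ (i - 2) * (W : ℤ) ^ (i - 1)) * X ^ i

/-- At a simple root `ρ` of `P`, the polynomial `P̃(z)` is `P(β_1 W z + ρ) / (β_1² W)`. -/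
theorem tricked_spec (P : ℤ[X]) (ρ : ℤ) (W : ℕ) (hρ : P.rootMultiplicity ρ = 1) :
    C (beta P ρ 1 ^ 2 * (W : ℤ)) * tricked P ρ W
      = P.comp (C (beta P ρ 1 * (W : ℤ)) * X + C ρ) := by
  have hP : P ≠ 0 := by rintro rfl; simp at hρ
  have hroot : P.eval ρ = 0 := (Polynomial.rootMultiplicity_pos hP).1 (by omega)
  have hd : 1 ≤ P.natDegree := by
    by_contra h
    have h0 : P.natDegree = 0 := by omega
    rw [Polynomial.eq_C_of_natDegree_eq_zero h0] at hroot hP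
    simp at hroot
    simp [hroot] at hP
  have hcomp : P.comp (C (beta P ρ 1 * (W : ℤ)) * X + C ρ)
      = (P.comp (X + C ρ)).comp (C (beta P ρ 1 * (W : ℤ)) * X) := by
    rw [Polynomial.comp_assoc]; simp
  have hdeg : (P.comp (X + C ρ)).natDegree = P.natDegree := by
    rw [Polynomial.natDegree_comp, Polynomial.natDegree_X_add_C, mul_one]
  have h0 : (P.comp (X + C ρ)).coeff 0 = 0 := by
    rw [Polynomial.coeff_zero_eq_eval_zero]; simp [hroot]
  have hexp : P.comp (X + C ρ) = C (beta P ρ 1) * X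
      + ∑ i ∈ Finset.Icc 2 P.natDegree, C (beta P ρ i) * X ^ i := by
    conv_lhs => rw [Polynomial.as_sum_range_C_mul_X_pow (P.comp (X + C ρ)), hdeg]
    rw [Finset.range_eq_Ico, Finset.sum_eq_sum_Ico_succ_bot (by omega),
      Finset.sum_eq_sum_Ico_succ_bot (by omega), h0]
    have : Finset.Ico (0 + 1 + 1) (P.natDegree + 1) = Finset.Icc 2 P.natDegree := by
      ext; simp
    rw [this]
    simp [beta]
  have hsum : ∀ (s : Finset ℕ) (f : ℕ → ℤ[X]) (q : ℤ[X]),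
      (∑ i ∈ s, f i).comp q = ∑ i ∈ s, (f i).comp q := fun s f q =>
    map_sum (Polynomial.compRingHom q) f s
  rw [hcomp, hexp, tricked]
  simp only [Polynomial.add_comp, Polynomial.mul_comp, Polynomial.C_comp, Polynomial.X_comp,
    hsum, Polynomial.pow_comp, mul_add, Finset.mul_sum]
  congr 1
  · simp only [C_mul, C_pow]; ring
  · refine Finset.sum_congr rfl fun i hi => ?_
    obtain ⟨k, rfl⟩ : ∃ k, i = k + 2 := ⟨i - 2, by simp at hi; omega⟩
    have : k + 2 - 1 = k + 1 := rfl
    simp only [C_mul, C_pow, Nat.add_sub_cancel, this]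
    ring

/-- `(N / W_d)^(1/d)`, with `W_d` the leading coefficient of `P̃` and `d` the degree of `P`. -/
def scale (P : ℤ[X]) (ρ : ℤ) (W N : ℕ) : ℝ :=
  ((N : ℝ) / ((tricked P ρ W).leadingCoeff : ℝ)) ^ (1 / (P.natDegree : ℝ))

open scoped Classical in
/-- The weight `ν̃ = N / (N/W_d)^(1/d) · 1_{P̃([(N/W_d)^(1/d)])}`. -/
def nuTilde (P : ℤ[X]) (ρ : ℤ) (W N : ℕ) (z : ℤ) : ℝ :=
  (N : ℝ) / scale P ρ W N *
    (if z ∈ (fun y : ℤ => (tricked P ρ W).eval y) '' interval (scale P ρ W N) then 1 else 0)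

open scoped Classical in
/-- The weight `ν(z) = d⁻¹ 1_{[N]}(z) (N/(z+1))^((d-1)/d)`. -/
def nu (d N : ℕ) (z : ℤ) : ℝ :=
  if z ∈ interval (N : ℝ) then
    (d : ℝ)⁻¹ * ((N : ℝ) / ((z : ℝ) + 1)) ^ (((d : ℝ) - 1) / (d : ℝ))
  else 0

/-- The difference `ν* = ν̃ - ν`. -/
def nuStar (P : ℤ[X]) (ρ : ℤ) (W N : ℕ) (z : ℤ) : ℝ :=
  nuTilde P ρ W N z - nu P.natDegree N z

/-- The weight `ν*` is finitely supported, so every sum of it over a progression is finite. -/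
theorem nuStar_support_finite (P : ℤ[X]) (ρ : ℤ) (W N : ℕ) :
    (Function.support (nuStar P ρ W N)).Finite := by
  have hfin : ∀ K : ℝ, (interval K).Finite := fun K =>
    (Set.finite_Icc (0 : ℤ) ⌊K - 1⌋).subset fun z hz => ⟨hz.1, Int.le_floor.2 hz.2⟩
  refine (((hfin (scale P ρ W N)).image fun y : ℤ => (tricked P ρ W).eval y).union
    (hfin (N : ℝ))).subset fun z hz => ?_
  by_contra h
  rw [Set.mem_union, not_or] at h
  exact hz (by rw [nuStar, nuTilde, nu, if_neg h.1, if_neg h.2]; simp)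

end

end NuUniformity

/-!
The sum is a difference of two exponential sums: one over the values of the tricked polynomial
`P̃` in a progression, and one against the smooth weight `ν`. Write `Λ` for the leading coefficient
of `P̃`, `d` for its degree and `M = (N / Λ) ^ (1 / d)`. Two estimates are played against each
other.

*Frequencies with a `W`-smooth denominator.* Since `P̃(x) - P̃(y) = (x - y) (1 + W k)`, the
polynomial `P̃` is injective on `ℤ` and permutes the residues to every modulus dividing a power of
`W`. Hence, on each residue class to such a modulus, the masses of `ν̃` and `ν` on an initial
segment differ by `O(N / M)` only: both are `N ^ (1 - 1 / d) t ^ (1 / d)` over the modulus, up to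
boundary effects (`norm_sum_residue_class_le`). If `θ` is close to a rational with such a
denominator, partial summation on each class shows that the sum is smaller than `N` by a power of
`N`, which beats every fixed power of `W` (`norm_tsum_le_of_smooth_denominator`).

*Large sums.* If the sum is at least `N / (V T)`, then one of the two exponential sums is large. For
the polynomial one, Weyl differencing and Vinogradov's lemma, with losses that are powers of `T`
only, give a `q ≤ T ^ K` such that `q θ Λ V ^ (d - 1)` is within `T ^ K / (M / V) ^ d` of an integer
(`exists_denominator_of_large_weyl_sum`). For the smooth one, monotonicity shows that `θ` is within
`T ^ K V / N` of an integer (`abs_sub_round_le_of_large_smooth_sum`). Either way `θ` is within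
`T ^ K V / N` of a rational with denominator `q Λ V ^ (d - 1)`
(`exists_denominator_of_large_tsum`).

Take `T` to be a power of `w` so small that `T ^ K < w`. Then all primes dividing `q` are below `w`,
and so are those dividing `Λ V ^ (d - 1)` once `w` exceeds the fixed factor `β_d β_1 ^ (d - 2)`
of `Λ` (which is `1` if `d = 1`). So the denominator divides a power of `W`, no information on
complete exponential sums is needed, and the first estimate contradicts the largeness of the sum.
For bounded `w` the trivial bound `5 N / V` suffices.
-/

namespace NuUniformity

open Polynomial

/-! ### The additive character -/

lemma e_eq_exp (x : ℝ) : e x = Complex.exp (Complex.I * ((2 * Real.pi * x : ℝ) : ℂ)) := by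
  rw [e]; congr 1; push_cast; ring

lemma e_add (x y : ℝ) : e (x + y) = e x * e y := by
  rw [e, e, e, ← Complex.exp_add]; congr 1; push_cast; ring

lemma norm_e (x : ℝ) : ‖e x‖ = 1 := by
  rw [e_eq_exp, mul_comm, Complex.norm_exp_ofReal_mul_I]

lemma e_intCast (n : ℤ) : e n = 1 := by
  rw [e, Complex.exp_eq_one_iff]
  exact ⟨n, by push_cast; ring⟩

lemma e_add_intCast (x : ℝ) (n : ℤ) : e (x + n) = e x := by
  rw [e_add, e_intCast, mul_one]

lemma e_nat_mul (x : ℝ) (n : ℕ) : e (x * n) = e x ^ n := by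
  rw [e, e, ← Complex.exp_nat_mul]; congr 1; push_cast; ring

lemma e_mul_conj (x y : ℝ) : e x * (starRingEnd ℂ) (e y) = e (x - y) := by
  have h : (starRingEnd ℂ) (e y) = e (-y) := by
    rw [e, e, ← Complex.exp_conj]; congr 1; simp [map_ofNat]
  rw [h, ← e_add, sub_eq_add_neg]

lemma norm_e_sub_one_le (x : ℝ) : ‖e x - 1‖ ≤ 2 * Real.pi * |x| := by
  rw [e_eq_exp]
  refine Real.norm_exp_I_mul_ofReal_sub_one_le.trans_eq ?_
  rw [Real.norm_eq_abs, abs_mul, abs_of_pos Real.two_pi_pos]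

/-- The distance from `e x` to `1` controls the distance from `x` to the nearest integer. -/
lemma four_mul_abs_sub_round_le (x : ℝ) : 4 * |x - round x| ≤ ‖e x - 1‖ := by
  have h1 : e x = e (x - round x) := by
    rw [← e_add_intCast (x - round x) (round x)]; simp
  have h2 := abs_sub_round x
  rw [h1]
  set t := x - round x
  have hpi := Real.pi_pos
  have key : ∀ s : ℝ, 0 ≤ s → s ≤ 1 / 2 → 2 * s ≤ Real.sin (Real.pi * s) := fun s hs hs' => by
    have := Real.mul_le_sin (x := Real.pi * s) (by positivity) (by nlinarith)
    calc 2 * s = 2 / Real.pi * (Real.pi * s) := by field_simp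
      _ ≤ _ := this
  rw [e_eq_exp, Complex.norm_exp_I_mul_ofReal_sub_one, Real.norm_eq_abs, abs_mul, abs_two,
    show 2 * Real.pi * t / 2 = Real.pi * t by ring]
  have h3 : 2 * |t| ≤ |Real.sin (Real.pi * t)| := by
    rcases le_total 0 t with h | h
    · rw [abs_of_nonneg h] at h2 ⊢
      exact (key t h h2).trans (le_abs_self _)
    · rw [abs_of_nonpos h] at h2 ⊢
      have := key (-t) (by linarith) h2
      rw [mul_neg Real.pi, Real.sin_neg] at this
      exact this.trans (neg_le_abs _)
  linarith

lemma norm_sum_e_mul_le (α : ℝ) (n : ℕ) :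
    ‖∑ x ∈ Finset.range n, e (α * x)‖ * (2 * |α - round α|) ≤ 1 := by
  have h1 : (∑ x ∈ Finset.range n, e (α * x)) * (e α - 1) = e α ^ n - 1 := by
    rw [← geom_sum_mul]; simp only [e_nat_mul]
  have h2 : ‖∑ x ∈ Finset.range n, e (α * x)‖ * ‖e α - 1‖ ≤ 2 := by
    rw [← norm_mul, h1]
    refine (norm_sub_le _ _).trans ?_
    rw [norm_pow, norm_e]; norm_num
  have h3 := mul_le_mul_of_nonneg_left (four_mul_abs_sub_round_le α)
    (norm_nonneg (∑ x ∈ Finset.range n, e (α * x)))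
  linarith

/-- Partial summation: a sum whose partial sums are at most `E` grows by at most the total
variation of a weight. -/
lemma norm_sum_mul_le_of_partial_sums (u g : ℕ → ℂ) (n : ℕ) {E : ℝ}
    (hE : ∀ t ≤ n, ‖∑ x ∈ Finset.range t, g x‖ ≤ E) :
    ‖∑ x ∈ Finset.range n, u x * g x‖ ≤
      E * (‖u (n - 1)‖ + ∑ x ∈ Finset.range (n - 1), ‖u (x + 1) - u x‖) := by
  have h := Finset.sum_range_by_parts u g n
  simp only [smul_eq_mul] at h
  rw [h]
  refine (norm_sub_le _ _).trans ?_
  rw [mul_add]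
  refine add_le_add ?_ ((norm_sum_le _ _).trans
    ((Finset.sum_le_sum fun i hi => ?_).trans_eq (Finset.mul_sum _ _ _).symm))
  · rw [norm_mul, mul_comm]
    exact mul_le_mul_of_nonneg_right (hE n le_rfl) (norm_nonneg _)
  · rw [norm_mul, mul_comm]
    have := Finset.mem_range.1 hi
    exact mul_le_mul_of_nonneg_right (hE _ (by omega)) (norm_nonneg _)

/-! ### Weyl differencing -/

/-- Weyl differencing: only nonnegative shifts occur, the negative ones being their conjugates. -/
lemma sq_norm_sum_le (F : ℕ → ℂ) (n : ℕ) :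
    ‖∑ x ∈ Finset.range n, F x‖ ^ 2 ≤
      2 * ∑ h ∈ Finset.range n,
        ‖∑ x ∈ Finset.range (n - h), F (x + h) * (starRingEnd ℂ) (F x)‖ := by
  have h1 : ∀ m : ℕ, ‖∑ x ∈ Finset.range m, F x‖ ^ 2 ≤
      2 * (∑ x ∈ Finset.range m,
        F x * (starRingEnd ℂ) (∑ k ∈ Finset.range (x + 1), F k)).re := by
    intro m
    induction m with
    | zero => simp
    | succ m ih =>
      rw [Finset.sum_range_succ (n := m), Finset.sum_range_succ (n := m), Complex.add_re]
      set S := ∑ x ∈ Finset.range m, F x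
      have e1 : ‖S + F m‖ ^ 2 = ‖S‖ ^ 2 + 2 * (F m * (starRingEnd ℂ) S).re + ‖F m‖ ^ 2 := by
        simp only [← Complex.normSq_eq_norm_sq, Complex.normSq_apply, Complex.add_re,
          Complex.add_im, Complex.mul_re, Complex.conj_re, Complex.conj_im]
        ring
      have e2 : (F m * (starRingEnd ℂ) (∑ k ∈ Finset.range (m + 1), F k)).re
          = (F m * (starRingEnd ℂ) S).re + ‖F m‖ ^ 2 := by
        rw [Finset.sum_range_succ, map_add, mul_add, Complex.add_re, Complex.mul_conj,
          Complex.ofReal_re, Complex.normSq_eq_norm_sq]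
      rw [e1, e2]
      have := sq_nonneg ‖F m‖
      linarith
  have h2 : ∑ x ∈ Finset.range n, F x * (starRingEnd ℂ) (∑ k ∈ Finset.range (x + 1), F k)
      = ∑ h ∈ Finset.range n, ∑ x ∈ Finset.range (n - h), F (x + h) * (starRingEnd ℂ) (F x) := by
    rw [← Finset.sum_range_diag_flip n fun h x => F (x + h) * (starRingEnd ℂ) (F x)]
    refine Finset.sum_congr rfl fun x _ => ?_
    rw [← Finset.sum_flip, map_sum, Finset.mul_sum]
    refine Finset.sum_congr rfl fun k hk => ?_
    have := Finset.mem_range.1 hk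
    rw [Nat.sub_add_cancel (by omega)]
  refine (h1 n).trans ?_
  rw [h2]
  refine mul_le_mul_of_nonneg_left ?_ zero_le_two
  exact (Complex.re_le_norm _).trans (norm_sum_le _ _)

lemma natDegree_taylor_sub_le (f : ℝ[X]) (d : ℕ) (hf : f.natDegree ≤ d + 2) (h : ℝ) :
    (taylor h f - f).natDegree ≤ d + 1 := by
  rw [natDegree_le_iff_coeff_eq_zero]
  intro n hn
  have hdeg : (hasseDeriv n f).natDegree = 0 := by
    have := natDegree_hasseDeriv_le f n
    omega
  rw [coeff_sub, taylor_coeff, eq_C_of_natDegree_eq_zero hdeg, eval_C, hasseDeriv_coeff]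
  simp

lemma coeff_taylor_sub (f : ℝ[X]) (d : ℕ) (hf : f.natDegree ≤ d + 2) (h : ℝ) :
    (taylor h f - f).coeff (d + 1) = (d + 2) * h * f.coeff (d + 2) := by
  have hdeg : (hasseDeriv (d + 1) f).natDegree ≤ 1 := by
    have := natDegree_hasseDeriv_le f (d + 1)
    omega
  rw [coeff_sub, taylor_coeff, eq_X_add_C_of_natDegree_le_one hdeg]
  simp only [eval_add, eval_mul, eval_C, eval_X, hasseDeriv_coeff]
  have : (1 + (d + 1)).choose (d + 1) = d + 2 := by
    rw [show 1 + (d + 1) = (d + 1) + 1 by ring, Nat.choose_succ_self_right]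
  rw [this, show 1 + (d + 1) = d + 2 by ring]
  simp
  ring

/-! ### Vinogradov's lemma on bounded multiples -/

/-- A set of at least `X / T` integers in `[0, X)` has two elements whose difference lies
between `ℓ` and `4Tℓ`. -/
lemma exists_gap (X T ℓ : ℕ) (hT : 1 ≤ T) (hℓ : 1 ≤ ℓ) (hX : 2 * T * ℓ ≤ X) (A : Finset ℕ)
    (hA : A ⊆ Finset.range X) (hcard : X ≤ T * A.card) :
    ∃ x ∈ A, ∃ y ∈ A, x + ℓ ≤ y ∧ y < x + 4 * T * ℓ := by
  have hL : 0 < 4 * T * ℓ := by positivity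
  have hmaps : ∀ a ∈ A, a / (4 * T * ℓ) ∈ Finset.range (X / (4 * T * ℓ) + 1) := by
    intro a ha
    have := Finset.mem_range.1 (hA ha)
    exact Finset.mem_range.2 (Nat.lt_succ_of_le (Nat.div_le_div_right this.le))
  have hlt : (Finset.range (X / (4 * T * ℓ) + 1)).card * ℓ < A.card := by
    rw [Finset.card_range]
    have h1 : X / (4 * T * ℓ) * (4 * T * ℓ) ≤ X := Nat.div_mul_le_self _ _
    have h2 : 4 * T * ((X / (4 * T * ℓ) + 1) * ℓ) < 4 * T * A.card := by
      have : 0 < T * ℓ := by positivity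
      nlinarith
    exact lt_of_mul_lt_mul_left h2 (by positivity)
  obtain ⟨k, -, hk⟩ := Finset.exists_lt_card_fiber_of_mul_lt_card_of_maps_to hmaps hlt
  set B := A.filter fun a => a / (4 * T * ℓ) = k
  have hne : B.Nonempty := Finset.card_pos.1 (by omega)
  have hmin := Finset.min'_mem B hne
  have hmax := Finset.max'_mem B hne
  have hsub : B ⊆ Finset.Icc (B.min' hne) (B.max' hne) := fun b hb =>
    Finset.mem_Icc.2 ⟨Finset.min'_le _ _ hb, Finset.le_max' _ _ hb⟩
  have hc := Finset.card_le_card hsub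
  rw [Nat.card_Icc] at hc
  refine ⟨_, (Finset.mem_filter.1 hmin).1, _, (Finset.mem_filter.1 hmax).1, by omega, ?_⟩
  have e1 := (Finset.mem_filter.1 hmin).2
  have e2 := (Finset.mem_filter.1 hmax).2
  have l1 := Nat.div_mul_le_self (B.min' hne) (4 * T * ℓ)
  have l2 := Nat.lt_div_mul_add hL (a := B.max' hne)
  rw [e1] at l1
  rw [e2] at l2
  omega

lemma abs_le_abs_sub_intCast {x : ℝ} (hx : |x| ≤ 1 / 2) (n : ℤ) : |x| ≤ |x - n| := by
  rcases eq_or_ne n 0 with rfl | hn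
  · simp
  · have h1 : (1 : ℝ) ≤ |(n : ℝ)| := by exact_mod_cast Int.one_le_abs hn
    have h2 := abs_sub_abs_le_abs_sub (n : ℝ) x
    rw [abs_sub_comm] at h2
    linarith

/-- If `h β` is within `ε` of an integer for at least `X / T` of the integers `0 ≤ h < X`, then
`β` is extremely close to a rational with a denominator at most `4T`. -/
lemma exists_denominator_of_many_multiples (β ε : ℝ) (X T : ℕ) (hT : 1 ≤ T)
    (hX : 16 * T ^ 2 ≤ X) (A : Finset ℕ) (hA : A ⊆ Finset.range X) (hcard : X ≤ T * A.card)
    (hεX : ε * X ≤ T) (hβ : ∀ h ∈ A, ∃ a : ℤ, |h * β - a| ≤ ε) :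
    ∃ q : ℕ, 1 ≤ q ∧ q ≤ 4 * T ∧ ∃ a : ℤ, |q * β - a| * X ≤ 256 * T ^ 3 * ε := by
  have hT0 : (1 : ℝ) ≤ T := by exact_mod_cast hT
  have hdiff : ∀ x ∈ A, ∀ y ∈ A, ∃ a : ℤ, |((y : ℝ) - x) * β - a| ≤ 2 * ε := by
    intro x hx y hy
    obtain ⟨a, ha⟩ := hβ x hx
    obtain ⟨b, hb⟩ := hβ y hy
    refine ⟨b - a, ?_⟩
    have : ((y : ℝ) - x) * β - ((b - a : ℤ) : ℝ) = (y * β - b) - (x * β - a) := by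
      push_cast; ring
    rw [this]
    exact (abs_sub _ _).trans (by linarith)
  -- a bounded gap gives the denominator
  obtain ⟨x, hx, y, hy, hxy, hyx⟩ := exists_gap X T 1 hT le_rfl (by nlinarith) A hA hcard
  obtain ⟨a, ha⟩ := hdiff x hx y hy
  have hq : ((y - x : ℕ) : ℝ) = (y : ℝ) - x := by push_cast [show x ≤ y by omega]; ring
  refine ⟨y - x, by omega, by omega, a, ?_⟩
  rw [← hq] at ha
  set q := y - x
  have hq4 : (q : ℝ) ≤ 4 * T := by
    have : q ≤ 4 * T := by omega
    exact_mod_cast this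
  have hq0 : (0 : ℝ) ≤ q := Nat.cast_nonneg q
  set γ := (q : ℝ) * β - a
  -- a gap of order `X` shows that the approximation is as good as claimed
  set ℓ := X / (16 * T ^ 2) with hℓdef
  have hℓ1 : 1 ≤ ℓ := (Nat.one_le_div_iff (by positivity)).2 hX
  have hℓX : ℓ * (16 * T ^ 2) ≤ X := Nat.div_mul_le_self _ _
  have hXℓ : X < ℓ * (16 * T ^ 2) + 16 * T ^ 2 := Nat.lt_div_mul_add (by positivity)
  have hℓX' : (ℓ : ℝ) * (16 * T ^ 2) ≤ X := by exact_mod_cast hℓX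
  have hXℓ' : (X : ℝ) ≤ 32 * T ^ 2 * ℓ := by
    have : X ≤ 32 * T ^ 2 * ℓ := by nlinarith
    exact_mod_cast this
  have hX0 : (0 : ℝ) < X := by
    have : (16 : ℝ) * T ^ 2 ≤ X := by exact_mod_cast hX
    nlinarith
  have hε0 : 0 ≤ ε := by
    obtain ⟨a, ha⟩ := hβ x hx
    exact (abs_nonneg _).trans ha
  obtain ⟨x', hx', y', hy', hxy', hyx'⟩ := exists_gap X T ℓ hT hℓ1 (by nlinarith) A hA hcard
  obtain ⟨b, hb⟩ := hdiff x' hx' y' hy'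
  have hxy1 : (x' : ℝ) + ℓ ≤ y' := by exact_mod_cast hxy'
  have hyx1 : (y' : ℝ) < x' + 4 * T * ℓ := by exact_mod_cast hyx'
  set D := (y' : ℝ) - x'
  have hD0 : 0 ≤ D := by
    have : (0 : ℝ) ≤ ℓ := Nat.cast_nonneg ℓ
    simp only [D]; linarith
  have hDγ : |D * γ| ≤ 1 / 2 := by
    rw [abs_mul, abs_of_nonneg hD0]
    have h1 : D * |γ| ≤ (4 * T * ℓ) * (2 * ε) :=
      mul_le_mul (by simp only [D]; linarith) ha (abs_nonneg _) (by positivity)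
    have h2 : (4 * T * ℓ) * (2 * ε) * (2 * T) ≤ ε * X := by
      calc (4 * T * ℓ) * (2 * ε) * (2 * T) = ε * (ℓ * (16 * (T : ℝ) ^ 2)) := by ring
        _ ≤ ε * X := mul_le_mul_of_nonneg_left hℓX' hε0
    have h3 : (4 * T * ℓ) * (2 * ε) * (2 * T) ≤ 1 / 2 * (2 * T) := by linarith
    exact h1.trans (le_of_mul_le_mul_right h3 (by positivity))
  have hDγ' : |D * γ| ≤ q * (2 * ε) := by
    obtain ⟨k, hk⟩ : ∃ k : ℤ, (k : ℝ) = q * b - D * a :=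
      ⟨q * b - ((y' : ℤ) - x') * a, by simp only [D]; push_cast; ring⟩
    have : D * γ - k = q * (D * β - b) := by rw [hk]; simp only [γ]; ring
    refine (abs_le_abs_sub_intCast hDγ k).trans ?_
    rw [this, abs_mul, abs_of_nonneg hq0]
    exact mul_le_mul_of_nonneg_left hb hq0
  calc |γ| * X ≤ |γ| * (32 * T ^ 2 * ℓ) := mul_le_mul_of_nonneg_left hXℓ' (abs_nonneg _)
    _ ≤ |γ| * (32 * T ^ 2 * D) := by
        refine mul_le_mul_of_nonneg_left ?_ (abs_nonneg _)
        refine mul_le_mul_of_nonneg_left ?_ (by positivity)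
        simp only [D]; linarith
    _ = 32 * T ^ 2 * |D * γ| := by rw [abs_mul, abs_of_nonneg hD0]; ring
    _ ≤ 32 * T ^ 2 * (4 * T * (2 * ε)) := by
        refine mul_le_mul_of_nonneg_left (hDγ'.trans ?_) (by positivity)
        exact mul_le_mul_of_nonneg_right hq4 (by linarith)
    _ = 256 * T ^ 3 * ε := by ring

/-! ### Weyl's inequality in inverse form -/

/-- A large proportion of the Weyl-differenced sums of a large exponential sum are large. -/
lemma card_large_differences (F : ℕ → ℂ) (X T : ℕ) (hF : ∀ x, ‖F x‖ = 1) (hT : 2 ≤ T)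
    (hX : 1 ≤ X) (hS : (X : ℝ) ≤ T * ‖∑ x ∈ Finset.range X, F x‖) :
    X ≤ T ^ 4 * ((Finset.range X).filter fun h => (X : ℝ) ≤ (T : ℝ) ^ 4 *
      ‖∑ x ∈ Finset.range (X - h), F (x + h) * (starRingEnd ℂ) (F x)‖).card := by
  set D : ℕ → ℝ := fun h => ‖∑ x ∈ Finset.range (X - h), F (x + h) * (starRingEnd ℂ) (F x)‖
    with hD
  set H := (Finset.range X).filter fun h => (X : ℝ) ≤ (T : ℝ) ^ 4 * D h with hH
  have hT2 : (2 : ℝ) ≤ T := by exact_mod_cast hT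
  have hX0 : (0 : ℝ) < X := by exact_mod_cast hX
  have hDX : ∀ h, D h ≤ X := by
    intro h
    refine (norm_sum_le _ _).trans ?_
    simp only [norm_mul, RCLike.norm_conj, hF, mul_one, Finset.sum_const, Finset.card_range,
      nsmul_eq_mul]
    exact_mod_cast Nat.sub_le X h
  -- the small differences contribute at most half of the sum forced by `hS`
  have hsum : (T : ℝ) ^ 4 * ∑ h ∈ Finset.range X, D h ≤ T ^ 4 * (H.card * X) + X * X := by
    rw [← Finset.sum_filter_add_sum_filter_not (Finset.range X)
      (fun h => (X : ℝ) ≤ (T : ℝ) ^ 4 * D h), mul_add]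
    refine add_le_add (mul_le_mul_of_nonneg_left ?_ (by positivity)) ?_
    · refine (Finset.sum_le_card_nsmul _ _ (X : ℝ) fun h _ => hDX h).trans_eq ?_
      rw [nsmul_eq_mul]
    · rw [Finset.mul_sum]
      refine (Finset.sum_le_card_nsmul _ _ (X : ℝ) fun h hh => ?_).trans ?_
      · exact (not_le.1 (Finset.mem_filter.1 hh).2).le
      · rw [nsmul_eq_mul]
        refine mul_le_mul_of_nonneg_right ?_ hX0.le
        have := Finset.card_filter_le (Finset.range X) fun h => ¬ (X : ℝ) ≤ (T : ℝ) ^ 4 * D h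
        rw [Finset.card_range] at this
        exact_mod_cast this
  have hsq : (X : ℝ) ^ 2 ≤ T ^ 2 * (2 * ∑ h ∈ Finset.range X, D h) := by
    calc (X : ℝ) ^ 2 ≤ (T * ‖∑ x ∈ Finset.range X, F x‖) ^ 2 := by gcongr
      _ = T ^ 2 * ‖∑ x ∈ Finset.range X, F x‖ ^ 2 := by ring
      _ ≤ _ := mul_le_mul_of_nonneg_left (sq_norm_sum_le F X) (by positivity)
  have h4 : (4 : ℝ) ≤ T ^ 2 := by nlinarith
  have key : (T : ℝ) ^ 2 * (X * X) ≤ T ^ 2 * (4 * T ^ 2 * H.card * X) := by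
    have e1 : (T : ℝ) ^ 2 * X ^ 2 ≤ 2 * (T ^ 4 * (H.card * X) + X * X) := by
      calc (T : ℝ) ^ 2 * X ^ 2 ≤ T ^ 2 * (T ^ 2 * (2 * ∑ h ∈ Finset.range X, D h)) := by gcongr
        _ = 2 * (T ^ 4 * ∑ h ∈ Finset.range X, D h) := by ring
        _ ≤ _ := by gcongr
    have e2 : 4 * ((X : ℝ) * X) ≤ T ^ 2 * (X * X) := mul_le_mul_of_nonneg_right h4 (by positivity)
    have e3 : (T : ℝ) ^ 2 * (4 * T ^ 2 * H.card * X) = 4 * (T ^ 4 * (H.card * X)) := by ring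
    rw [e3]
    linarith [e1, e2, show (T : ℝ) ^ 2 * X ^ 2 = T ^ 2 * (X * X) by ring]
  have key2 : (X : ℝ) ≤ 4 * T ^ 2 * H.card :=
    le_of_mul_le_mul_right (le_of_mul_le_mul_left key (by positivity)) hX0
  have key3 : (X : ℝ) ≤ T ^ 4 * H.card := by
    refine key2.trans (mul_le_mul_of_nonneg_right ?_ (Nat.cast_nonneg _))
    nlinarith [sq_nonneg ((T : ℝ) ^ 2)]
  exact_mod_cast key3

/-- Weyl's inequality for the top coefficient, in inverse form and with polynomial losses only: if
the sum of `e (f x)` over `x < X` is at least `X / T`, then the coefficient of degree `d + 1` of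
`f` has a multiple by a positive integer at most `T ^ K` within `T ^ K / X ^ (d + 1)` of an
integer. -/
theorem exists_denominator_of_large_weyl_sum (d : ℕ) : ∃ K : ℕ, ∀ (f : ℝ[X]) (X T : ℕ), 2 ≤ T →
    f.natDegree ≤ d + 1 → 1 ≤ X → (X : ℝ) ≤ T * ‖∑ x ∈ Finset.range X, e (f.eval (x : ℝ))‖ →
    ∃ q : ℕ, 1 ≤ q ∧ q ≤ T ^ K ∧
      ∃ a : ℤ, |q * f.coeff (d + 1) - a| * (X : ℝ) ^ (d + 1) ≤ (T : ℝ) ^ K := by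
  induction d with
  | zero =>
    refine ⟨1, fun f X T hT hf hX hS => ⟨1, le_rfl, by rw [pow_one]; omega, round (f.coeff 1), ?_⟩⟩
    have h1 : ‖∑ x ∈ Finset.range X, e (f.eval (x : ℝ))‖
        = ‖∑ x ∈ Finset.range X, e (f.coeff 1 * x)‖ := by
      have : ∀ x : ℕ, e (f.eval (x : ℝ)) = e (f.coeff 0) * e (f.coeff 1 * x) := by
        intro x
        rw [← e_add]
        conv_lhs => rw [eq_X_add_C_of_natDegree_le_one hf]
        simp [add_comm]
      simp only [this]
      rw [← Finset.mul_sum, norm_mul, norm_e, one_mul]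
    rw [h1] at hS
    have h2 := norm_sum_e_mul_le (f.coeff 1) X
    have h3 := abs_nonneg (f.coeff 1 - round (f.coeff 1))
    have h4 := mul_le_mul_of_nonneg_left hS h3
    have h5 : (0 : ℝ) ≤ T := Nat.cast_nonneg T
    simp only [Nat.cast_one, one_mul, zero_add, pow_one]
    nlinarith
  | succ d ih =>
    obtain ⟨K, ih⟩ := ih
    set k := 4 * (K + d + 1) with hk
    refine ⟨(4 + 2 * k) * (d + 2), fun f X T hT hf hX hS => ?_⟩
    set α := f.coeff (d + 1 + 1) with hα
    have hT2 : (2 : ℝ) ≤ T := by exact_mod_cast hT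
    have hT1 : (1 : ℝ) ≤ T := by linarith
    have hX0 : (0 : ℝ) < X := by exact_mod_cast hX
    set T₁ := T ^ k with hT₁
    have hT₁1 : 1 ≤ T₁ := Nat.one_le_pow _ _ (by omega)
    -- Vinogradov's lemma needs `X` large; otherwise denominator `1` is good enough
    rcases lt_or_ge X (16 * T₁ ^ 2) with hsmall | hlarge
    · refine ⟨1, le_rfl, Nat.one_le_pow _ _ (by omega), round α, ?_⟩
      have h1 : |((1 : ℕ) : ℝ) * α - round α| ≤ 1 := by
        have := abs_sub_round α
        simp only [Nat.cast_one, one_mul]; linarith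
      have h2 : (X : ℝ) ≤ (T : ℝ) ^ (4 + 2 * k) := by
        have : (X : ℝ) ≤ 16 * (T₁ : ℝ) ^ 2 := by exact_mod_cast hsmall.le
        refine this.trans ?_
        rw [hT₁, pow_add]
        push_cast
        rw [← pow_mul, mul_comm k 2]
        refine mul_le_mul_of_nonneg_right ?_ (by positivity)
        calc (16 : ℝ) = 2 ^ 4 := by norm_num
          _ ≤ _ := by gcongr
      calc _ ≤ 1 * ((T : ℝ) ^ (4 + 2 * k)) ^ (d + 1 + 1) := by gcongr
        _ = _ := by rw [one_mul, ← pow_mul]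
    have hcardH := card_large_differences (fun x => e (f.eval (x : ℝ))) X T
      (fun x => norm_e _) hT hX hS
    set H := (Finset.range X).filter fun h => (X : ℝ) ≤ (T : ℝ) ^ 4 *
      ‖∑ x ∈ Finset.range (X - h), e (f.eval ((x + h : ℕ) : ℝ)) *
        (starRingEnd ℂ) (e (f.eval (x : ℝ)))‖ with hH
    set U := T ^ 4 with hU
    have hU2 : 2 ≤ U := by
      have : 2 ^ 4 ≤ T ^ 4 := Nat.pow_le_pow_left hT 4
      omega
    have hU1 : (1 : ℝ) ≤ U := by
      have : 1 ≤ U := by omega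
      exact_mod_cast this
    have hUT₁ : U ^ (K + d + 1) = T₁ := by rw [hU, hT₁, hk, ← pow_mul]
    -- the induction hypothesis for each large differenced sum
    have hq : ∀ h ∈ H, ∃ q : ℕ, 1 ≤ q ∧ q ≤ U ^ K ∧ ∃ a : ℤ,
        |h * (q * (d + 2) * α) - a| ≤ T₁ / (X : ℝ) ^ (d + 1) := by
      intro h hh
      obtain ⟨hhX, hlarge⟩ := Finset.mem_filter.1 hh
      have hhX := Finset.mem_range.1 hhX
      have hsum : ∑ x ∈ Finset.range (X - h),
          e (f.eval ((x + h : ℕ) : ℝ)) * (starRingEnd ℂ) (e (f.eval (x : ℝ)))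
          = ∑ x ∈ Finset.range (X - h), e ((taylor (h : ℝ) f - f).eval (x : ℝ)) := by
        refine Finset.sum_congr rfl fun x _ => ?_
        rw [e_mul_conj, eval_sub, taylor_eval]
        push_cast; rfl
      rw [hsum] at hlarge
      have hUcast : ((U : ℕ) : ℝ) = (T : ℝ) ^ 4 := by rw [hU]; push_cast; rfl
      rw [← hUcast] at hlarge
      have hXh : ((X - h : ℕ) : ℝ) ≤ X := by exact_mod_cast Nat.sub_le X h
      obtain ⟨q, hq1, hq2, a, ha⟩ := ih (taylor (h : ℝ) f - f) (X - h) U hU2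
        (natDegree_taylor_sub_le f d hf h) (by omega) (hXh.trans hlarge)
      refine ⟨q, hq1, hq2, a, ?_⟩
      have hnorm : ‖∑ x ∈ Finset.range (X - h), e ((taylor (h : ℝ) f - f).eval (x : ℝ))‖
          ≤ ((X - h : ℕ) : ℝ) := by
        refine (norm_sum_le _ _).trans ?_
        simp [norm_e]
      have hX' : (X : ℝ) ≤ U * ((X - h : ℕ) : ℝ) :=
        hlarge.trans (mul_le_mul_of_nonneg_left hnorm (Nat.cast_nonneg _))
      rw [coeff_taylor_sub f d hf] at ha
      rw [le_div_iff₀ (by positivity)]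
      have e1 : (h : ℝ) * (q * (d + 2) * α) = q * ((d + 2) * h * f.coeff (d + 2)) := by
        rw [hα]; ring
      rw [e1]
      calc |(q : ℝ) * ((d + 2) * h * f.coeff (d + 2)) - a| * (X : ℝ) ^ (d + 1)
          ≤ |(q : ℝ) * ((d + 2) * h * f.coeff (d + 2)) - a|
              * (U * ((X - h : ℕ) : ℝ)) ^ (d + 1) := by gcongr
        _ = U ^ (d + 1) * (|(q : ℝ) * ((d + 2) * h * f.coeff (d + 2)) - a|
              * ((X - h : ℕ) : ℝ) ^ (d + 1)) := by ring
        _ ≤ (U : ℝ) ^ (d + 1) * (U : ℝ) ^ K := by gcongr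
        _ = T₁ := by rw [← hUT₁]; push_cast; ring
    choose! q hq1 hq2 hqa using hq
    -- one denominator occurs for many differences
    have hmaps : ∀ h ∈ H, q h ∈ Finset.Icc 1 (U ^ K) := fun h hh =>
      Finset.mem_Icc.2 ⟨hq1 h hh, hq2 h hh⟩
    have hUK : 1 ≤ U ^ K := Nat.one_le_pow _ _ (by omega)
    have hUK0 : (0 : ℝ) < (U ^ K : ℕ) := by exact_mod_cast hUK
    obtain ⟨q₀, hq₀, hfib⟩ := Finset.exists_le_card_fiber_of_nsmul_le_card_of_maps_to
      (M := ℝ) (b := (H.card : ℝ) / (U ^ K : ℕ)) hmaps ⟨1, Finset.mem_Icc.2 ⟨le_rfl, hUK⟩⟩ (by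
        rw [Nat.card_Icc, nsmul_eq_mul, Nat.add_sub_cancel, mul_div_cancel₀ _ hUK0.ne'])
    set A := H.filter fun h => q h = q₀ with hA
    rw [div_le_iff₀ hUK0] at hfib
    have hfib' : H.card ≤ A.card * U ^ K := by exact_mod_cast hfib
    obtain ⟨hq₀1, hq₀2⟩ := Finset.mem_Icc.1 hq₀
    have hXA : X ≤ T₁ * A.card := by
      calc X ≤ U * H.card := hcardH
        _ ≤ U * (A.card * U ^ K) := Nat.mul_le_mul_left _ hfib'
        _ = U ^ (K + 1) * A.card := by ring
        _ ≤ U ^ (K + d + 1) * A.card :=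
          Nat.mul_le_mul_right _ (Nat.pow_le_pow_right (by omega) (by omega))
        _ = T₁ * A.card := by rw [hUT₁]
    obtain ⟨q₁, hq₁1, hq₁2, a, ha⟩ := exists_denominator_of_many_multiples
      (q₀ * (d + 2) * α) (T₁ / (X : ℝ) ^ (d + 1)) X T₁ hT₁1 hlarge A
      ((Finset.filter_subset _ _).trans (Finset.filter_subset _ _)) hXA
      (by
        have h1 : (1 : ℝ) ≤ (X : ℝ) ^ d := one_le_pow₀ (by exact_mod_cast hX)
        rw [pow_succ, div_mul_eq_mul_div, mul_div_mul_right _ _ hX0.ne']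
        exact div_le_self (Nat.cast_nonneg _) h1)
      (fun h hh => by
        obtain ⟨hhH, hhq⟩ := Finset.mem_filter.1 hh
        have := hqa h hhH
        rwa [hhq] at this)
    have hd2 : d + 2 ≤ T ^ (d + 2) :=
      (Nat.lt_two_pow_self (n := d + 2)).le.trans (Nat.pow_le_pow_left hT _)
    refine ⟨q₁ * (q₀ * (d + 2)), Nat.mul_pos hq₁1 (Nat.mul_pos hq₀1 (by omega)), ?_, a, ?_⟩
    · have hUK' : U ^ K ≤ T₁ := hUT₁ ▸ Nat.pow_le_pow_right (by omega) (by omega)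
      calc q₁ * (q₀ * (d + 2)) ≤ (4 * T₁) * (T₁ * T ^ (d + 2)) :=
            Nat.mul_le_mul hq₁2 (Nat.mul_le_mul (hq₀2.trans hUK') hd2)
        _ ≤ (T ^ 2 * T₁) * (T₁ * T ^ (d + 2)) := by
            refine Nat.mul_le_mul_right _ (Nat.mul_le_mul_right _ ?_)
            nlinarith
        _ = T ^ (2 + 2 * k + (d + 2)) := by rw [hT₁]; ring
        _ ≤ T ^ ((4 + 2 * k) * (d + 2)) := Nat.pow_le_pow_right (by omega) (by nlinarith)
    · have e1 : ((q₁ * (q₀ * (d + 2)) : ℕ) : ℝ) * α = q₁ * (q₀ * (d + 2) * α) := by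
        push_cast; ring
      rw [e1]
      calc |(q₁ : ℝ) * (q₀ * (d + 2) * α) - a| * (X : ℝ) ^ (d + 1 + 1)
          = (|(q₁ : ℝ) * (q₀ * (d + 2) * α) - a| * X) * (X : ℝ) ^ (d + 1) := by ring
        _ ≤ (256 * T₁ ^ 3 * (T₁ / (X : ℝ) ^ (d + 1))) * (X : ℝ) ^ (d + 1) := by gcongr
        _ = 2 ^ 8 * T₁ ^ 4 := by field_simp; norm_num
        _ ≤ (T : ℝ) ^ 8 * T₁ ^ 4 := by gcongr
        _ = (T : ℝ) ^ (8 + 4 * k) := by rw [hT₁]; push_cast; ring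
        _ ≤ (T : ℝ) ^ ((4 + 2 * k) * (d + 2)) := pow_le_pow_right₀ hT1 (by nlinarith)

/-! ### Sums along residue classes -/

/-- The number of `x < n` congruent to `s < m` modulo `m` is `⌈(n - s) / m⌉`, written here as
`(n + m - 1 - s) / m` to avoid a truncated difference. -/
lemma sum_filter_mod_eq {A : Type*} [AddCommMonoid A] (f : ℕ → A) (n m s : ℕ) (hs : s < m) :
    ∑ x ∈ Finset.range n with x % m = s, f x
      = ∑ u ∈ Finset.range ((n + m - 1 - s) / m), f (m * u + s) := by
  have hm : 0 < m := by omega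
  have hlt : ∀ u, u < (n + m - 1 - s) / m ↔ m * u + s < n := by
    intro u
    rw [← Nat.succ_le_iff, Nat.le_div_iff_mul_le hm, Nat.succ_mul, mul_comm]
    omega
  symm
  refine Finset.sum_nbij (fun u => m * u + s) (fun u hu => ?_) (fun u _ v _ huv => ?_)
    (fun x hx => ?_) (fun _ _ => rfl)
  · rw [Finset.mem_range, hlt] at hu
    simp [hu, Nat.mod_eq_of_lt hs]
  · have : m * u = m * v := by simpa using huv
    exact Nat.eq_of_mul_eq_mul_left hm this
  · obtain ⟨hx1, hx2⟩ := Finset.mem_filter.1 (Finset.mem_coe.1 hx)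
    have h1 := Nat.div_add_mod x m
    rw [hx2] at h1
    refine ⟨x / m, ?_, h1⟩
    rw [Finset.mem_coe, Finset.mem_range, hlt, h1]
    exact Finset.mem_range.1 hx1

lemma mul_count_bounds (n m s : ℕ) (hs : s < m) :
    m * ((n + m - 1 - s) / m) ≤ n + m ∧ n ≤ m * ((n + m - 1 - s) / m) + m := by
  have hm : 0 < m := by omega
  have h1 := Nat.div_mul_le_self (n + m - 1 - s) m
  have h2 := Nat.lt_div_mul_add hm (a := n + m - 1 - s)
  rw [mul_comm] at h1 h2
  omega

lemma card_filter_mod_bounds (n m s : ℕ) (hs : s < m) :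
    (n : ℝ) / m - 1 ≤ ((Finset.range n).filter fun x => x % m = s).card ∧
      (((Finset.range n).filter fun x => x % m = s).card : ℝ) ≤ n / m + 1 := by
  have hm : 0 < m := by omega
  have hm' : (0 : ℝ) < m := by exact_mod_cast hm
  have h := sum_filter_mod_eq (fun _ => 1) n m s hs
  simp only [Finset.sum_const, smul_eq_mul, mul_one, Finset.card_range] at h
  rw [h]
  obtain ⟨h1, h2⟩ := mul_count_bounds n m s hs
  have h1' : (m : ℝ) * ((n + m - 1 - s) / m : ℕ) ≤ n + m := by exact_mod_cast h1
  have h2' : (n : ℝ) ≤ m * ((n + m - 1 - s) / m : ℕ) + m := by exact_mod_cast h2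
  constructor
  · rw [sub_le_iff_le_add, div_le_iff₀ hm']; linarith
  · rw [← sub_le_iff_le_add, le_div_iff₀ hm']; linarith

/-! ### Sums of the density `p t ^ (p - 1)` -/

/-- The graph of the concave function `t ↦ t ^ p` lies below its tangents. -/
lemma rpow_sub_rpow_le {p s t : ℝ} (hp0 : 0 ≤ p) (hp1 : p ≤ 1) (hs : 0 < s) (ht : 0 ≤ t) :
    t ^ p - s ^ p ≤ p * s ^ (p - 1) * (t - s) := by
  have h := rpow_one_add_le_one_add_mul_self (s := (t - s) / s)
    (by rw [le_div_iff₀ hs]; linarith) hp0 hp1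
  have e1 : 1 + (t - s) / s = t / s := by field_simp; ring
  rw [e1, Real.div_rpow ht hs.le, div_le_iff₀ (Real.rpow_pos_of_pos hs p)] at h
  rw [Real.rpow_sub_one hs.ne']
  calc t ^ p - s ^ p ≤ (1 + p * ((t - s) / s)) * s ^ p - s ^ p := by linarith
    _ = _ := by ring

/-- The sum of the derivative of `t ↦ t ^ p` over a progression telescopes, by the tangent
inequality, into the increment of `t ^ p / m`; the first term costs at most `1`. -/
lemma sum_density_le {p : ℝ} (hp0 : 0 ≤ p) (hp1 : p ≤ 1) {m r : ℕ} (hr : r < m) (n : ℕ) :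
    ∑ x ∈ Finset.range n, p * ((m : ℝ) * x + r + 1) ^ (p - 1) ≤ ((m : ℝ) * n) ^ p / m + 1 := by
  have hm : (0 : ℝ) < m := by exact_mod_cast (by omega : 0 < m)
  have hrm : (r : ℝ) + 1 ≤ m := by exact_mod_cast hr
  have hr0 : (0 : ℝ) ≤ r := Nat.cast_nonneg r
  have main : ∀ k : ℕ, ∑ x ∈ Finset.range (k + 1), p * ((m : ℝ) * x + r + 1) ^ (p - 1)
      ≤ ((m : ℝ) * k + r + 1) ^ p / m + 1 := by
    intro k
    induction k with
    | zero =>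
      have h1 : ((r : ℝ) + 1) ^ (p - 1) ≤ 1 :=
        Real.rpow_le_one_of_one_le_of_nonpos (by linarith) (by linarith)
      have h2 : (0 : ℝ) ≤ ((r : ℝ) + 1) ^ p / m := by positivity
      have h3 : (0 : ℝ) ≤ ((r : ℝ) + 1) ^ (p - 1) := by positivity
      simp only [zero_add, Finset.sum_range_one, Nat.cast_zero, mul_zero]
      nlinarith
    | succ k ih =>
      rw [Finset.sum_range_succ]
      have hs : (0 : ℝ) < (m : ℝ) * (k + 1 : ℕ) + r + 1 := by positivity
      have h := rpow_sub_rpow_le (s := (m : ℝ) * (k + 1 : ℕ) + r + 1)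
        (t := (m : ℝ) * k + r + 1) hp0 hp1 hs (by positivity)
      have e1 : ((m : ℝ) * k + r + 1) - ((m : ℝ) * (k + 1 : ℕ) + r + 1) = -m := by
        push_cast; ring
      rw [e1] at h
      have h2 : p * ((m : ℝ) * (k + 1 : ℕ) + r + 1) ^ (p - 1) ≤
          (((m : ℝ) * (k + 1 : ℕ) + r + 1) ^ p - ((m : ℝ) * k + r + 1) ^ p) / m := by
        rw [le_div_iff₀ hm]; linarith
      rw [sub_div] at h2
      linarith
  cases n with
  | zero =>
    simp only [Finset.range_zero, Finset.sum_empty, Nat.cast_zero, mul_zero]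
    have : (0 : ℝ) ≤ 0 ^ p / m := by positivity
    linarith
  | succ k =>
    refine (main k).trans ?_
    have : ((m : ℝ) * k + r + 1) ^ p ≤ ((m : ℝ) * (k + 1 : ℕ)) ^ p := by
      refine Real.rpow_le_rpow (by positivity) ?_ hp0
      push_cast; linarith
    gcongr

/-- The lower bound matching `sum_density_le`. -/
lemma le_sum_density {p : ℝ} (hp0 : 0 < p) (hp1 : p ≤ 1) {m r : ℕ} (hr : r < m) (n : ℕ) :
    ((m : ℝ) * n) ^ p / m - 1 ≤ ∑ x ∈ Finset.range n, p * ((m : ℝ) * x + r + 1) ^ (p - 1) := by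
  have hm : (0 : ℝ) < m := by exact_mod_cast (by omega : 0 < m)
  have hrm : (r : ℝ) + 1 ≤ m := by exact_mod_cast hr
  have hr0 : (0 : ℝ) ≤ r := Nat.cast_nonneg r
  have main : (((m : ℝ) * n + r + 1) ^ p - ((r : ℝ) + 1) ^ p) / m ≤
      ∑ x ∈ Finset.range n, p * ((m : ℝ) * x + r + 1) ^ (p - 1) := by
    induction n with
    | zero => simp
    | succ k ih =>
      rw [Finset.sum_range_succ]
      have h := rpow_sub_rpow_le (s := (m : ℝ) * k + r + 1)
        (t := (m : ℝ) * (k + 1 : ℕ) + r + 1) hp0.le hp1 (by positivity) (by positivity)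
      have e1 : ((m : ℝ) * (k + 1 : ℕ) + r + 1) - ((m : ℝ) * k + r + 1) = m := by
        push_cast; ring
      rw [e1, ← div_le_iff₀ hm] at h
      rw [sub_div] at h ih ⊢
      linarith
  have h1 : ((r : ℝ) + 1) ^ p ≤ m := by
    calc ((r : ℝ) + 1) ^ p ≤ ((r : ℝ) + 1) ^ (1 : ℝ) :=
          Real.rpow_le_rpow_of_exponent_le (by linarith) hp1
      _ ≤ m := by rw [Real.rpow_one]; exact hrm
  have h2 : ((m : ℝ) * n) ^ p ≤ ((m : ℝ) * n + r + 1) ^ p :=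
    Real.rpow_le_rpow (by positivity) (by linarith) hp0.le
  refine le_trans ?_ main
  rw [sub_le_iff_le_add, ← sub_le_iff_le_add', ← sub_div, div_le_one hm]
  linarith

/-- Increasing the argument of `t ↦ t ^ p` by `m ≥ 1` increases the value by at most `m`. -/
lemma rpow_le_rpow_add {p a b m : ℝ} (hp0 : 0 ≤ p) (hp1 : p ≤ 1) (ha : 0 ≤ a) (hb : 0 ≤ b)
    (hm : 1 ≤ m) (hab : a ≤ b + m) : a ^ p ≤ b ^ p + m := by
  calc a ^ p ≤ (b + m) ^ p := Real.rpow_le_rpow ha hab hp0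
    _ ≤ b ^ p + m ^ p := Real.rpow_add_le_add_rpow hb (by linarith) hp0 hp1
    _ ≤ b ^ p + m ^ (1 : ℝ) := by
      have := Real.rpow_le_rpow_of_exponent_le hm hp1
      linarith
    _ = b ^ p + m := by rw [Real.rpow_one]

/-! ### Polynomials adapted to `W` -/

/-- The properties of the `W`-tricked polynomial that the argument uses: its difference quotients
are congruent to `1` modulo `W`, its leading coefficient is `b W ^ (d - 1)`, and on the natural
numbers it is close to its leading term, uniformly in `W`: the constants `b` and `B` are meant to be
independent of `W`. -/
structure IsAdapted (Q : ℤ[X]) (W d B b : ℕ) : Prop where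
  one_le_degree : 1 ≤ d
  natDegree_eq : Q.natDegree = d
  leadingCoeff_eq : Q.leadingCoeff = b * (W : ℤ) ^ (d - 1)
  one_le_b : 1 ≤ b
  two_le_W : 2 ≤ W
  unit_slope : ∀ x y : ℤ, ∃ k : ℤ, Q.eval x - Q.eval y = (x - y) * (1 + W * k)
  growth : ∀ y : ℕ, |((Q.eval (y : ℤ) : ℤ) : ℝ) - Q.leadingCoeff * (y : ℝ) ^ d|
    ≤ B * Q.leadingCoeff * (y : ℝ) ^ (d - 1)

namespace IsAdapted

variable {Q : ℤ[X]} {W d B b : ℕ}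

lemma one_le_leadingCoeff (h : IsAdapted Q W d B b) : (1 : ℝ) ≤ Q.leadingCoeff := by
  have h1 : 1 ≤ b * W ^ (d - 1) :=
    Nat.mul_pos h.one_le_b (Nat.pow_pos (by have := h.two_le_W; omega))
  rw [h.leadingCoeff_eq]
  exact_mod_cast h1

lemma dvd_eval_sub_iff (h : IsAdapted Q W d B b) {m J : ℕ} (hm : m ∣ W ^ J) (x y : ℤ) :
    (m : ℤ) ∣ Q.eval x - Q.eval y ↔ (m : ℤ) ∣ x - y := by
  obtain ⟨k, hk⟩ := h.unit_slope x y
  rw [hk]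
  have hcop : IsCoprime (m : ℤ) (1 + W * k) := by
    have h1 : IsCoprime ((W : ℤ) ^ J) (1 + W * k) :=
      IsCoprime.pow_left ⟨-k, 1, by ring⟩
    exact h1.of_isCoprime_of_dvd_left (by exact_mod_cast hm)
  exact ⟨fun hd => hcop.dvd_of_dvd_mul_right hd, fun hd => hd.mul_right _⟩

lemma eval_injective (h : IsAdapted Q W d B b) : Function.Injective fun x : ℤ => Q.eval x := by
  intro x y hxy
  obtain ⟨k, hk⟩ := h.unit_slope x y
  have h0 : Q.eval x - Q.eval y = 0 := sub_eq_zero.2 hxy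
  rw [h0] at hk
  rcases mul_eq_zero.1 hk.symm with h1 | h1
  · exact sub_eq_zero.1 h1
  · have h2 : (W : ℤ) ∣ 1 := ⟨-k, by linarith⟩
    have h3 : W ∣ 1 := by exact_mod_cast h2
    have := Nat.le_of_dvd one_pos h3
    have := h.two_le_W
    omega

/-- To a modulus composed of primes dividing `W`, the polynomial is a permutation. -/
lemma exists_residue (h : IsAdapted Q W d B b) {m J : ℕ} (hm : m ∣ W ^ J) (t : ℤ) :
    ∃ s < m, ∀ y : ℕ, (m : ℤ) ∣ Q.eval (y : ℤ) - t ↔ y % m = s := by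
  have hm0 : 0 < m := by
    have hW := h.two_le_W
    exact Nat.pos_of_dvd_of_pos hm (Nat.pow_pos (by omega))
  have : NeZero m := ⟨hm0.ne'⟩
  have hinj : Function.Injective fun z : ZMod m => ((Q.eval (z.val : ℤ) : ℤ) : ZMod m) := by
    intro z z' hz
    have h1 : (m : ℤ) ∣ (z.val : ℤ) - z'.val := by
      rw [← h.dvd_eval_sub_iff hm, ← ZMod.intCast_zmod_eq_zero_iff_dvd, Int.cast_sub]
      exact sub_eq_zero.2 hz
    rw [← ZMod.intCast_zmod_eq_zero_iff_dvd, Int.cast_sub, sub_eq_zero] at h1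
    simpa using h1
  obtain ⟨z, hz⟩ := Finite.surjective_of_injective hinj (t : ZMod m)
  refine ⟨z.val, z.val_lt, fun y => ?_⟩
  have h1 : (m : ℤ) ∣ Q.eval (z.val : ℤ) - t := by
    rw [← ZMod.intCast_zmod_eq_zero_iff_dvd, Int.cast_sub]
    exact sub_eq_zero.2 hz
  have h2 : Q.eval (y : ℤ) - t = (Q.eval (y : ℤ) - Q.eval (z.val : ℤ)) + (Q.eval (z.val : ℤ) - t) := by
    ring
  rw [h2, dvd_add_left h1, h.dvd_eval_sub_iff hm, ← ZMod.intCast_zmod_eq_zero_iff_dvd,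
    Int.cast_sub, sub_eq_zero]
  simp only [Int.cast_natCast]
  rw [ZMod.natCast_eq_natCast_iff, Nat.ModEq, Nat.mod_eq_of_lt z.val_lt]

lemma eval_le (h : IsAdapted Q W d B b) (y : ℕ) :
    ((Q.eval (y : ℤ) : ℤ) : ℝ) ≤ Q.leadingCoeff * ((y : ℝ) + B) ^ d := by
  have h1 := (abs_le.1 (h.growth y)).2
  have hΛ := h.one_le_leadingCoeff
  obtain ⟨k, hk⟩ : ∃ k, d = k + 1 := ⟨d - 1, by have := h.one_le_degree; omega⟩
  rw [hk, Nat.add_sub_cancel] at h1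
  rw [hk]
  have hy : (0 : ℝ) ≤ y := Nat.cast_nonneg y
  have hB : (0 : ℝ) ≤ B := Nat.cast_nonneg B
  have h2 : (y : ℝ) ^ k * (y + B) ≤ ((y : ℝ) + B) ^ (k + 1) := by
    rw [pow_succ]; gcongr; linarith
  have h3 := mul_le_mul_of_nonneg_left h2 (by linarith : (0 : ℝ) ≤ Q.leadingCoeff)
  calc ((Q.eval (y : ℤ) : ℤ) : ℝ) ≤ Q.leadingCoeff * ((y : ℝ) ^ k * (y + B)) := by
        rw [pow_succ] at h1; linarith
    _ ≤ _ := h3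

lemma le_eval (h : IsAdapted Q W d B b) (y : ℕ) (hy : B ≤ y) :
    Q.leadingCoeff * ((y : ℝ) - B) ^ d ≤ ((Q.eval (y : ℤ) : ℤ) : ℝ) := by
  have h1 := (abs_le.1 (h.growth y)).1
  have hΛ := h.one_le_leadingCoeff
  obtain ⟨k, hk⟩ : ∃ k, d = k + 1 := ⟨d - 1, by have := h.one_le_degree; omega⟩
  rw [hk, Nat.add_sub_cancel] at h1
  rw [hk]
  have hB : (0 : ℝ) ≤ B := Nat.cast_nonneg B
  have hyB : (0 : ℝ) ≤ (y : ℝ) - B := by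
    have : (B : ℝ) ≤ y := by exact_mod_cast hy
    linarith
  have h2 : ((y : ℝ) - B) ^ (k + 1) ≤ (y : ℝ) ^ k * (y - B) := by
    rw [pow_succ]; gcongr; linarith
  have h3 := mul_le_mul_of_nonneg_left h2 (by linarith : (0 : ℝ) ≤ Q.leadingCoeff)
  refine h3.trans ?_
  rw [pow_succ] at h1; linarith

lemma eval_nonneg (h : IsAdapted Q W d B b) (y : ℕ) (hy : B ≤ y) : 0 ≤ Q.eval (y : ℤ) := by
  have h1 := h.le_eval y hy
  have hyB : (0 : ℝ) ≤ (y : ℝ) - B := by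
    have : (B : ℝ) ≤ y := by exact_mod_cast hy
    linarith
  have hΛ := h.one_le_leadingCoeff
  have h2 : (0 : ℝ) ≤ Q.leadingCoeff * ((y : ℝ) - B) ^ d := by positivity
  exact_mod_cast h2.trans h1

lemma eval_lt_of_add_lt (h : IsAdapted Q W d B b) {y : ℕ} {u : ℝ} (hy : (y : ℝ) + B < u) :
    ((Q.eval (y : ℤ) : ℤ) : ℝ) < Q.leadingCoeff * u ^ d := by
  have hΛ := h.one_le_leadingCoeff
  have hd := h.one_le_degree
  refine (h.eval_le y).trans_lt ?_
  have : ((y : ℝ) + B) ^ d < u ^ d := pow_lt_pow_left₀ hy (by positivity) (by omega)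
  exact mul_lt_mul_of_pos_left this (by linarith)

lemma lt_add_of_eval_lt (h : IsAdapted Q W d B b) {y : ℕ} {u : ℝ} (hu : 0 ≤ u)
    (hy : ((Q.eval (y : ℤ) : ℤ) : ℝ) < Q.leadingCoeff * u ^ d) : (y : ℝ) < u + B := by
  by_contra! hlt
  have hΛ := h.one_le_leadingCoeff
  have hB : B ≤ y := by
    have : (B : ℝ) ≤ y := by linarith
    exact_mod_cast this
  have h1 := h.le_eval y hB
  have h2 : u ^ d ≤ ((y : ℝ) - B) ^ d := pow_le_pow_left₀ hu (by linarith) d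
  have h3 := mul_le_mul_of_nonneg_left h2 (by linarith : (0 : ℝ) ≤ Q.leadingCoeff)
  linarith

/-- The values below `Λ u ^ d` of the polynomial on a residue class are taken at about `u / m`
points. -/
lemma abs_card_sub_le (h : IsAdapted Q W d B b) {m s : ℕ} (hs : s < m) {u M : ℝ} (hu : 0 ≤ u)
    (hM : 0 ≤ M) (huM : u ≤ M + m) :
    |(((Finset.range ⌊M⌋₊).filter fun y : ℕ => y % m = s ∧ 0 ≤ Q.eval (y : ℤ) ∧
      ((Q.eval (y : ℤ) : ℤ) : ℝ) < Q.leadingCoeff * u ^ d).card : ℝ) - u / m| ≤ 2 * B + 4 := by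
  set A := (Finset.range ⌊M⌋₊).filter fun y : ℕ => y % m = s ∧ 0 ≤ Q.eval (y : ℤ) ∧
      ((Q.eval (y : ℤ) : ℤ) : ℝ) < Q.leadingCoeff * u ^ d with hA
  have hm0 : 0 < m := by omega
  have hm : (1 : ℝ) ≤ m := by exact_mod_cast hm0
  have hmpos : (0 : ℝ) < m := by linarith
  have hB0 : (0 : ℝ) ≤ B := Nat.cast_nonneg B
  rw [abs_le]
  constructor
  -- the points between `B` and `u - m - B - 1` are below `M` and have values in `[0, Λ u ^ d)`
  · set v := ⌈u - m - B - 1⌉₊ with hv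
    have hsub : ((Finset.range v).filter fun y => y % m = s) \ Finset.range B ⊆ A := by
      intro y hy
      obtain ⟨hy1, hy2⟩ := Finset.mem_sdiff.1 hy
      obtain ⟨hy1, hy3⟩ := Finset.mem_filter.1 hy1
      rw [Finset.mem_range] at hy1
      rw [Finset.mem_range, not_lt] at hy2
      have hyu : (y : ℝ) < u - m - B - 1 := Nat.lt_ceil.1 hy1
      refine Finset.mem_filter.2 ⟨Finset.mem_range.2 ?_, hy3, h.eval_nonneg y hy2,
        h.eval_lt_of_add_lt (by linarith)⟩
      rw [← Nat.succ_le_iff, Nat.le_floor_iff hM]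
      push_cast
      linarith
    have hc1 := Finset.card_le_card hsub
    have hc2 := Finset.le_card_sdiff (Finset.range B) ((Finset.range v).filter fun y => y % m = s)
    rw [Finset.card_range] at hc2
    have hc3 : (((Finset.range v).filter fun y => y % m = s).card : ℝ) ≤ A.card + B := by
      have : ((Finset.range v).filter fun y => y % m = s).card ≤ A.card + B := by omega
      exact_mod_cast this
    have hc4 := (card_filter_mod_bounds v m s hs).1
    have hc5 : u - m - B - 1 ≤ v := Nat.le_ceil _
    have hc6 : u / m - 1 - (B + 1) ≤ (v : ℝ) / m := by
      have e1 : (u - m - B - 1) / m = u / m - 1 - (B + 1) / m := by field_simp; ring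
      have e2 : ((B : ℝ) + 1) / m ≤ B + 1 := div_le_self (by linarith) hm
      have e3 : (u - m - B - 1) / m ≤ (v : ℝ) / m := by gcongr
      linarith
    linarith
  · have hsub : A ⊆ (Finset.range ⌈u + B⌉₊).filter fun y => y % m = s := by
      intro y hy
      obtain ⟨-, hy2, -, hy4⟩ := Finset.mem_filter.1 hy
      exact Finset.mem_filter.2 ⟨Finset.mem_range.2
        (Nat.lt_ceil.2 (h.lt_add_of_eval_lt hu hy4)), hy2⟩
    have hc1 : (A.card : ℝ) ≤ ((Finset.range ⌈u + B⌉₊).filter fun y => y % m = s).card := by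
      exact_mod_cast Finset.card_le_card hsub
    have hc2 := (card_filter_mod_bounds ⌈u + B⌉₊ m s hs).2
    have hc3 : ((⌈u + B⌉₊ : ℕ) : ℝ) ≤ u + B + 1 := (Nat.ceil_lt_add_one (by linarith)).le
    have hc4 : ((⌈u + B⌉₊ : ℕ) : ℝ) / m ≤ u / m + (B + 1) := by
      have e2 : ((B : ℝ) + 1) / m ≤ B + 1 := div_le_self (by linarith) hm
      have e3 : ((⌈u + B⌉₊ : ℕ) : ℝ) / m ≤ (u + B + 1) / m := by gcongr
      have e4 : (u + B + 1) / m = u / m + (B + 1) / m := by ring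
      linarith
    linarith

end IsAdapted

/-! ### The two weights on a progression -/

section Weights

variable {P : ℤ[X]} {ρ : ℤ} {W N B b : ℕ}

lemma mem_interval_iff {K : ℝ} (hK : 0 ≤ K) (z : ℤ) :
    z ∈ interval K ↔ ∃ y : ℕ, y < ⌊K⌋₊ ∧ (y : ℤ) = z := by
  have key : ∀ y : ℕ, y < ⌊K⌋₊ ↔ (y : ℝ) ≤ K - 1 := fun y => by
    rw [← Nat.succ_le_iff, Nat.le_floor_iff hK]
    push_cast
    exact le_sub_iff_add_le.symm
  constructor
  · rintro ⟨h0, h1⟩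
    lift z to ℕ using h0
    exact ⟨z, (key z).2 (by exact_mod_cast h1), rfl⟩
  · rintro ⟨y, hy, rfl⟩
    exact ⟨Int.natCast_nonneg y, by exact_mod_cast (key y).1 hy⟩

lemma scale_pos (h : IsAdapted (tricked P ρ W) W P.natDegree B b) (hN : 1 ≤ N) :
    0 < scale P ρ W N := by
  have hΛ := h.one_le_leadingCoeff
  have hN' : (0 : ℝ) < N := by exact_mod_cast hN
  exact Real.rpow_pos_of_pos (by positivity) _

lemma rpow_one_div_pow {x : ℝ} (hx : 0 ≤ x) {d : ℕ} (hd : 1 ≤ d) :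
    (x ^ (1 / (d : ℝ))) ^ d = x := by
  rw [one_div, Real.rpow_inv_natCast_pow hx (by omega)]

lemma leadingCoeff_mul_rpow_pow (h : IsAdapted (tricked P ρ W) W P.natDegree B b) {x : ℝ}
    (hx : 0 ≤ x) : ((tricked P ρ W).leadingCoeff : ℝ) *
      ((x / (tricked P ρ W).leadingCoeff) ^ (1 / (P.natDegree : ℝ))) ^ P.natDegree = x := by
  have hΛ := h.one_le_leadingCoeff
  rw [rpow_one_div_pow (by positivity) h.one_le_degree]
  field_simp

lemma leadingCoeff_mul_scale_pow (h : IsAdapted (tricked P ρ W) W P.natDegree B b) :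
    ((tricked P ρ W).leadingCoeff : ℝ) * scale P ρ W N ^ P.natDegree = N :=
  leadingCoeff_mul_rpow_pow h (Nat.cast_nonneg N)

lemma nuTilde_eq (h : IsAdapted (tricked P ρ W) W P.natDegree B b) (hN : 1 ≤ N) (z : ℤ)
    [Decidable (∃ y : ℕ, y < ⌊scale P ρ W N⌋₊ ∧ (tricked P ρ W).eval (y : ℤ) = z)] :
    nuTilde P ρ W N z = if ∃ y : ℕ, y < ⌊scale P ρ W N⌋₊ ∧ (tricked P ρ W).eval (y : ℤ) = z
      then (N : ℝ) / scale P ρ W N else 0 := by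
  have hM := scale_pos h hN
  have key : z ∈ (fun y : ℤ => (tricked P ρ W).eval y) '' interval (scale P ρ W N) ↔
      ∃ y : ℕ, y < ⌊scale P ρ W N⌋₊ ∧ (tricked P ρ W).eval (y : ℤ) = z := by
    constructor
    · rintro ⟨x, hx, rfl⟩
      obtain ⟨y, hy, rfl⟩ := (mem_interval_iff hM.le x).1 hx
      exact ⟨y, hy, rfl⟩
    · rintro ⟨y, hy, rfl⟩
      exact ⟨y, (mem_interval_iff hM.le _).2 ⟨y, hy, rfl⟩, rfl⟩
  rw [nuTilde]
  by_cases hz : ∃ y : ℕ, y < ⌊scale P ρ W N⌋₊ ∧ (tricked P ρ W).eval (y : ℤ) = z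
  · rw [if_pos (key.2 hz), if_pos hz, mul_one]
  · rw [if_neg fun hh => hz (key.1 hh), if_neg hz, mul_zero]

lemma nu_natCast_of_lt {d : ℕ} (hd : 1 ≤ d) {z : ℕ} (hz : z < N) :
    nu d N z = (N : ℝ) ^ (1 - 1 / (d : ℝ)) *
      (1 / (d : ℝ) * ((z : ℝ) + 1) ^ (1 / (d : ℝ) - 1)) := by
  have hd0 : (d : ℝ) ≠ 0 := by
    have : (0 : ℝ) < d := by exact_mod_cast hd
    exact this.ne'
  rw [nu, if_pos ((mem_interval_iff (Nat.cast_nonneg N) _).2 ⟨z, by simpa using hz, rfl⟩)]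
  have e1 : ((d : ℝ) - 1) / d = 1 - 1 / d := by field_simp
  have e2 : (1 : ℝ) / d - 1 = -(1 - 1 / d) := by ring
  have hz0 : (0 : ℝ) ≤ (z : ℝ) + 1 := by positivity
  rw [e1, e2, Real.rpow_neg hz0, Int.cast_natCast, Real.div_rpow (Nat.cast_nonneg N) hz0]
  ring

lemma nu_natCast_of_le (d : ℕ) {z : ℕ} (hz : N ≤ z) : nu d N z = 0 := by
  rw [nu, if_neg]
  rw [mem_interval_iff (Nat.cast_nonneg N)]
  rintro ⟨y, hy, hyz⟩
  rw [Nat.floor_natCast] at hy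
  omega

lemma nu_of_neg (d : ℕ) {z : ℤ} (hz : z < 0) : nu d N z = 0 := by
  rw [nu, if_neg]
  intro h
  exact absurd h.1 (by omega)

/-- The number of integers `x ≥ 0` with `V x + r < N`. -/
def progLength (N V r : ℕ) : ℕ := (N + V - 1 - r) / V

lemma lt_progLength_iff {V r : ℕ} (hr : r < V) (x : ℕ) :
    x < progLength N V r ↔ V * x + r < N := by
  rw [progLength, ← Nat.succ_le_iff, Nat.le_div_iff_mul_le (by omega), Nat.succ_mul, mul_comm]
  omega

/-- The sum of `ν̃` over a progression against any weight, as a sum over the arguments of the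
polynomial. -/
lemma sum_mul_nuTilde (h : IsAdapted (tricked P ρ W) W P.natDegree B b) (hN : 1 ≤ N) {V r : ℕ}
    (hr : r < V) (F : ℕ → ℂ) (t : ℕ) :
    ∑ x ∈ Finset.range t, F x * (nuTilde P ρ W N ((V : ℤ) * x + r) : ℂ) =
      ((N / scale P ρ W N : ℝ) : ℂ) * ∑ y ∈ (Finset.range ⌊scale P ρ W N⌋₊).filter
        (fun y : ℕ => (V : ℤ) ∣ (tricked P ρ W).eval (y : ℤ) - r ∧
          0 ≤ (tricked P ρ W).eval (y : ℤ) ∧ (tricked P ρ W).eval (y : ℤ) < V * t),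
        F ((tricked P ρ W).eval (y : ℤ) / V).toNat := by
  classical
  have hV0 : (0 : ℤ) < V := by exact_mod_cast (by omega : 0 < V)
  have hrV : (r : ℤ) < V := by exact_mod_cast hr
  have hr0 : (0 : ℤ) ≤ r := Int.natCast_nonneg r
  set Q := tricked P ρ W
  set G := (Finset.range ⌊scale P ρ W N⌋₊).filter
        (fun y : ℕ => (V : ℤ) ∣ Q.eval (y : ℤ) - r ∧
          0 ≤ Q.eval (y : ℤ) ∧ Q.eval (y : ℤ) < V * t) with hG
  have hx : ∀ y ∈ G, ∃ x : ℕ, x < t ∧ Q.eval (y : ℤ) = V * x + r ∧ (Q.eval (y : ℤ) / V).toNat = x := by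
    intro y hy
    obtain ⟨-, ⟨k, hk⟩, h2, h3⟩ := Finset.mem_filter.1 hy
    have hQ : Q.eval (y : ℤ) = V * k + r := by linarith
    rw [hQ] at h2 h3 ⊢
    have hk0 : 0 ≤ k := by
      by_contra! hneg
      nlinarith
    lift k to ℕ using hk0
    refine ⟨k, ?_, rfl, ?_⟩
    · have : (V : ℤ) * k < V * t := by linarith
      exact_mod_cast lt_of_mul_lt_mul_left this hV0.le
    · rw [add_comm, Int.add_mul_ediv_left _ _ hV0.ne', Int.ediv_eq_zero_of_lt hr0 hrV]
      simp
  have hinj : Set.InjOn (fun y : ℕ => (Q.eval (y : ℤ) / V).toNat) G := by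
    intro y hy y' hy' hyy
    obtain ⟨x, -, hx1, hx2⟩ := hx y hy
    obtain ⟨x', -, hx1', hx2'⟩ := hx y' hy'
    simp only at hyy
    rw [hx2, hx2'] at hyy
    have : Q.eval (y : ℤ) = Q.eval (y' : ℤ) := by rw [hx1, hx1', hyy]
    exact_mod_cast h.eval_injective this
  rw [← Finset.sum_image (f := F) hinj, Finset.mul_sum]
  symm
  have hsub : G.image (fun y : ℕ => (Q.eval (y : ℤ) / V).toNat) ⊆ Finset.range t := by
    intro x hx'
    obtain ⟨y, hy, rfl⟩ := Finset.mem_image.1 hx'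
    obtain ⟨x, hxt, -, hx2⟩ := hx y hy
    rw [hx2]
    exact Finset.mem_range.2 hxt
  refine Finset.sum_subset_zero_on_sdiff hsub (fun x hx' => ?_) (fun x hx' => ?_)
  · obtain ⟨hxt, hxG⟩ := Finset.mem_sdiff.1 hx'
    rw [nuTilde_eq h hN, if_neg]
    · simp
    rintro ⟨y, hy, hyx⟩
    refine hxG (Finset.mem_image.2 ⟨y, Finset.mem_filter.2 ⟨Finset.mem_range.2 hy, ?_⟩, ?_⟩)
    · rw [hyx]
      have hxt' : (x : ℤ) + 1 ≤ t := by exact_mod_cast Finset.mem_range.1 hxt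
      refine ⟨⟨x, by ring⟩, by positivity, ?_⟩
      nlinarith
    · rw [hyx, add_comm, Int.add_mul_ediv_left _ _ hV0.ne', Int.ediv_eq_zero_of_lt hr0 hrV]
      simp
  · obtain ⟨y, hy, rfl⟩ := Finset.mem_image.1 hx'
    obtain ⟨x, hxt, hx1, hx2⟩ := hx y hy
    rw [nuTilde_eq h hN, hx2, if_pos ⟨y, Finset.mem_range.1 (Finset.mem_filter.1 hy).1, hx1⟩,
      mul_comm]

/-- The sum in question, as the difference of a sum over arguments of the polynomial and a smooth
exponential sum. -/
lemma tsum_eq_sub (h : IsAdapted (tricked P ρ W) W P.natDegree B b) (hN : 1 ≤ N) {V r : ℕ}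
    (hr : r < V) (θ : ℝ) :
    ∑' z : ℤ, e (θ * (z : ℝ)) * ((nuStar P ρ W N ((V : ℤ) * z + r) : ℝ) : ℂ) =
      ((N / scale P ρ W N : ℝ) : ℂ) * ∑ y ∈ (Finset.range ⌊scale P ρ W N⌋₊).filter
        (fun y : ℕ => (V : ℤ) ∣ (tricked P ρ W).eval (y : ℤ) - r),
        e (θ * (((tricked P ρ W).eval (y : ℤ) - r) / V : ℤ))
      - ∑ x ∈ Finset.range (progLength N V r),
        e (θ * x) * (nu P.natDegree N ((V : ℤ) * x + r) : ℂ) := by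
  classical
  have hV0 : (0 : ℤ) < V := by exact_mod_cast (by omega : 0 < V)
  set Q := tricked P ρ W
  set G := (Finset.range ⌊scale P ρ W N⌋₊).filter
        (fun y : ℕ => (V : ℤ) ∣ Q.eval (y : ℤ) - r) with hG
  have hinj : Set.InjOn (fun y : ℕ => (Q.eval (y : ℤ) - r) / (V : ℤ)) G := by
    intro y hy y' hy' hyy
    have h1 := Int.ediv_mul_cancel (Finset.mem_filter.1 (Finset.mem_coe.1 hy)).2
    have h2 := Int.ediv_mul_cancel (Finset.mem_filter.1 (Finset.mem_coe.1 hy')).2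
    simp only at hyy
    rw [hyy, h2] at h1
    have : Q.eval (y : ℤ) = Q.eval (y' : ℤ) := by linarith
    exact_mod_cast h.eval_injective this
  have hzero1 : ∀ z ∉ G.image (fun y : ℕ => (Q.eval (y : ℤ) - r) / (V : ℤ)),
      nuTilde P ρ W N ((V : ℤ) * z + r) = 0 := by
    intro z hz
    rw [nuTilde_eq h hN, if_neg]
    rintro ⟨y, hy, hyz⟩
    refine hz (Finset.mem_image.2 ⟨y, Finset.mem_filter.2 ⟨Finset.mem_range.2 hy, ⟨z, ?_⟩⟩, ?_⟩)
    · rw [hyz]; ring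
    · rw [hyz, add_sub_cancel_right, Int.mul_ediv_cancel_left _ hV0.ne']
  have hzero2 : ∀ z ∉ (Finset.range (progLength N V r)).image (fun x : ℕ => (x : ℤ)),
      nu P.natDegree N ((V : ℤ) * z + r) = 0 := by
    intro z hz
    rcases lt_or_ge z 0 with hneg | hpos
    · exact nu_of_neg _ (by nlinarith)
    · lift z to ℕ using hpos
      have h1 : ¬ z < progLength N V r := fun hlt =>
        hz (Finset.mem_image.2 ⟨z, Finset.mem_range.2 hlt, rfl⟩)
      rw [lt_progLength_iff hr, not_lt] at h1
      exact_mod_cast nu_natCast_of_le (N := N) P.natDegree h1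
  have hs1 : ∀ z ∉ G.image (fun y : ℕ => (Q.eval (y : ℤ) - r) / (V : ℤ)),
      e (θ * (z : ℝ)) * ((nuTilde P ρ W N ((V : ℤ) * z + r) : ℝ) : ℂ) = 0 := fun z hz => by
    rw [hzero1 z hz]; simp
  have hs2 : ∀ z ∉ (Finset.range (progLength N V r)).image (fun x : ℕ => (x : ℤ)),
      e (θ * (z : ℝ)) * ((nu P.natDegree N ((V : ℤ) * z + r) : ℝ) : ℂ) = 0 := fun z hz => by
    rw [hzero2 z hz]; simp
  have hsplit : ∀ z : ℤ, e (θ * (z : ℝ)) * ((nuStar P ρ W N ((V : ℤ) * z + r) : ℝ) : ℂ) =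
      e (θ * (z : ℝ)) * ((nuTilde P ρ W N ((V : ℤ) * z + r) : ℝ) : ℂ) -
      e (θ * (z : ℝ)) * ((nu P.natDegree N ((V : ℤ) * z + r) : ℝ) : ℂ) := fun z => by
    rw [nuStar]; push_cast; ring
  simp only [hsplit]
  rw [(summable_of_ne_finset_zero hs1).tsum_sub (summable_of_ne_finset_zero hs2),
    tsum_eq_sum hs1, tsum_eq_sum hs2, Finset.sum_image hinj,
    Finset.sum_image (fun a _ b _ hab => by exact_mod_cast hab), Finset.mul_sum]
  congr 1
  refine Finset.sum_congr rfl fun y hy => ?_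
  obtain ⟨hy1, hy2⟩ := Finset.mem_filter.1 hy
  rw [Int.mul_ediv_cancel' hy2, sub_add_cancel, nuTilde_eq h hN,
    if_pos ⟨y, Finset.mem_range.1 hy1, rfl⟩, mul_comm]

/-- The sum of `ν` over an initial segment of a progression. -/
lemma abs_sum_nu_sub_le {d : ℕ} (hd : 1 ≤ d) {m r n : ℕ} (hr : r < m)
    (hn : ∀ x < n, m * x + r < N) :
    |∑ x ∈ Finset.range n, nu d N ((m : ℤ) * x + r) -
      (N : ℝ) ^ (1 - 1 / (d : ℝ)) * (((m : ℝ) * n) ^ (1 / (d : ℝ)) / m)|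
      ≤ (N : ℝ) ^ (1 - 1 / (d : ℝ)) := by
  have hd1 : (1 : ℝ) ≤ d := by exact_mod_cast hd
  have hp0 : 0 < 1 / (d : ℝ) := by positivity
  have hp1 : 1 / (d : ℝ) ≤ 1 := (div_le_one (by linarith)).2 hd1
  have e1 : ∑ x ∈ Finset.range n, nu d N ((m : ℤ) * x + r) = (N : ℝ) ^ (1 - 1 / (d : ℝ)) *
      ∑ x ∈ Finset.range n, 1 / (d : ℝ) * ((m : ℝ) * x + r + 1) ^ (1 / (d : ℝ) - 1) := by
    rw [Finset.mul_sum]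
    refine Finset.sum_congr rfl fun x hx => ?_
    have := nu_natCast_of_lt hd (hn x (Finset.mem_range.1 hx))
    push_cast at this
    exact this
  rw [e1, ← mul_sub, abs_mul, abs_of_nonneg (by positivity)]
  refine mul_le_of_le_one_right (by positivity) ?_
  rw [abs_le]
  exact ⟨by linarith [le_sum_density hp0 hp1 hr n], by linarith [sum_density_le hp0.le hp1 hr n]⟩

lemma div_scale_eq (h : IsAdapted (tricked P ρ W) W P.natDegree B b) (hN : 1 ≤ N) :
    (N : ℝ) / scale P ρ W N = (N : ℝ) ^ (1 - 1 / (P.natDegree : ℝ)) *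
      ((tricked P ρ W).leadingCoeff : ℝ) ^ (1 / (P.natDegree : ℝ)) := by
  have hΛ := h.one_le_leadingCoeff
  have hN' : (0 : ℝ) < N := by exact_mod_cast hN
  have h1 : (0 : ℝ) < (N : ℝ) ^ (1 / (P.natDegree : ℝ)) := Real.rpow_pos_of_pos hN' _
  rw [scale, Real.div_rpow hN'.le (by linarith), Real.rpow_sub hN', Real.rpow_one]
  field_simp

/-- On each residue class to a modulus composed of primes dividing `W`, the weights `ν̃` and `ν`
have almost the same mass on every initial segment. -/
lemma norm_sum_residue_class_le (h : IsAdapted (tricked P ρ W) W P.natDegree B b) (hN : 1 ≤ N)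
    {V r q a J t : ℕ} (hr : r < V) (ha : a < q) (hVq : V * q ∣ W ^ J)
    (ht : t ≤ progLength N V r) :
    ‖∑ x ∈ Finset.range t, if x % q = a then
      ((nuStar P ρ W N ((V : ℤ) * x + r) : ℝ) : ℂ) else 0‖
      ≤ (2 * B + 6) * (N / scale P ρ W N) := by
  have hΛ := h.one_le_leadingCoeff
  have hM := scale_pos h hN
  have hd := h.one_le_degree
  have hd1 : (1 : ℝ) ≤ P.natDegree := by exact_mod_cast hd
  have hq0 : 0 < q := by omega
  have hV0 : 0 < V := by omega
  have hV0' : (0 : ℤ) < V := by exact_mod_cast hV0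
  have hm0 : 0 < V * q := Nat.mul_pos hV0 hq0
  have hm1 : (1 : ℝ) ≤ (V : ℝ) * q := by exact_mod_cast hm0
  have htN : ∀ x < t, V * x + r < N := fun x hx => (lt_progLength_iff hr x).1 (by omega)
  have hVt : (V : ℝ) * t ≤ N + V := by
    have : V * t ≤ N + V := by
      rcases Nat.eq_zero_or_pos t with rfl | h0
      · omega
      · obtain ⟨t', rfl⟩ : ∃ t', t = t' + 1 := ⟨t - 1, by omega⟩
        have := htN t' (by omega)
        rw [mul_add]; omega
    exact_mod_cast this
  set Q := tricked P ρ W with hQ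
  set Λ : ℝ := (Q.leadingCoeff : ℝ) with hΛdef
  set p : ℝ := 1 / (P.natDegree : ℝ) with hp
  have hp0 : 0 ≤ p := by positivity
  have hp1 : p ≤ 1 := (div_le_one (by linarith)).2 hd1
  set R : ℝ := (N : ℝ) ^ (1 - p) with hR
  have hR0 : 0 ≤ R := by positivity
  have hΛ0 : 0 < Λ := by linarith
  have hNM : (N : ℝ) / scale P ρ W N = R * Λ ^ p := div_scale_eq h hN
  have hΛp : 1 ≤ Λ ^ p := Real.one_le_rpow hΛ hp0
  have hRle : R ≤ N / scale P ρ W N := by rw [hNM]; exact le_mul_of_one_le_right hR0 hΛp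
  have hrm : V * a + r < V * q := by
    have : V * (a + 1) ≤ V * q := Nat.mul_le_mul_left _ ha
    rw [mul_add] at this; omega
  -- the mass of `ν`
  have hν : |∑ x ∈ Finset.range t, (if x % q = a then nu P.natDegree N ((V : ℤ) * x + r) else 0)
      - R * (((V : ℝ) * t) ^ p / (V * q))| ≤ 2 * R := by
    rw [← Finset.sum_filter, sum_filter_mod_eq _ t q a ha]
    set n := (t + q - 1 - a) / q with hn
    have hlt : ∀ u < n, V * q * u + (V * a + r) < N := by
      intro u hu
      rw [hn, ← Nat.succ_le_iff, Nat.le_div_iff_mul_le hq0, Nat.succ_mul, mul_comm] at hu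
      have := htN (q * u + a) (by omega)
      calc V * q * u + (V * a + r) = V * (q * u + a) + r := by ring
        _ < N := this
    have h1 := abs_sum_nu_sub_le (N := N) hd hrm hlt
    have e1 : ∀ u : ℕ, ((V * q : ℕ) : ℤ) * u + ((V * a + r : ℕ) : ℤ)
        = (V : ℤ) * ((q * u + a : ℕ) : ℤ) + r := fun u => by push_cast; ring
    simp only [e1] at h1
    obtain ⟨hc1, hc2⟩ := mul_count_bounds t q a ha
    rw [← hn] at hc1 hc2
    have hc1' : (V : ℝ) * q * n ≤ V * t + V * q := by
      have : (q : ℝ) * n ≤ t + q := by exact_mod_cast hc1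
      nlinarith [(Nat.cast_nonneg V : (0 : ℝ) ≤ V)]
    have hc2' : (V : ℝ) * t ≤ V * q * n + V * q := by
      have : (t : ℝ) ≤ q * n + q := by exact_mod_cast hc2
      nlinarith [(Nat.cast_nonneg V : (0 : ℝ) ≤ V)]
    have h2 := rpow_le_rpow_add hp0 hp1 (by positivity) (by positivity) hm1 hc1'
    have h3 := rpow_le_rpow_add hp0 hp1 (by positivity) (by positivity) hm1 hc2'
    have h4 : |((V : ℝ) * q * n) ^ p / (V * q) - ((V : ℝ) * t) ^ p / (V * q)| ≤ 1 := by
      rw [← sub_div, abs_div, abs_of_pos (by linarith : (0 : ℝ) < V * q), div_le_one (by linarith),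
        abs_le]
      constructor <;> linarith
    have h5 : |R * (((V : ℝ) * q * n) ^ p / (V * q)) - R * (((V : ℝ) * t) ^ p / (V * q))| ≤ R := by
      rw [← mul_sub, abs_mul, abs_of_nonneg hR0]
      exact mul_le_of_le_one_right hR0 h4
    push_cast at h1
    refine (abs_sub_le _ (R * (((V : ℝ) * q * n) ^ p / (V * q))) _).trans ?_
    push_cast
    linarith
  -- the mass of `ν̃`
  have hν' : |∑ x ∈ Finset.range t, (if x % q = a then nuTilde P ρ W N ((V : ℤ) * x + r) else 0)
      - R * (((V : ℝ) * t) ^ p / (V * q))| ≤ (2 * B + 4) * (N / scale P ρ W N) := by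
    obtain ⟨s, hs, hsy⟩ := h.exists_residue hVq ((V : ℤ) * a + r)
    set u : ℝ := ((V : ℝ) * t / Λ) ^ p with hu
    have huΛ : Λ * u ^ P.natDegree = V * t := leadingCoeff_mul_rpow_pow h (by positivity)
    have huM : u ≤ scale P ρ W N + ((V * q : ℕ) : ℝ) := by
      refine rpow_le_rpow_add hp0 hp1 (by positivity) (by positivity)
        (by exact_mod_cast hm0) ?_
      have e1 : (V : ℝ) * t / Λ ≤ (N + V) / Λ := by gcongr
      have e2 : (V : ℝ) / Λ ≤ V := div_le_self (Nat.cast_nonneg _) hΛ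
      have e3 : (V : ℝ) ≤ ((V * q : ℕ) : ℝ) := by
        exact_mod_cast Nat.le_mul_of_pos_right V hq0
      rw [add_div] at e1
      linarith
    have hcard := h.abs_card_sub_le hs (u := u) (by positivity) hM.le huM
    have hsum := sum_mul_nuTilde h hN hr (fun x => if x % q = a then 1 else 0) t
    have hfilter : ((Finset.range ⌊scale P ρ W N⌋₊).filter
        (fun y : ℕ => (V : ℤ) ∣ Q.eval (y : ℤ) - r ∧
          0 ≤ Q.eval (y : ℤ) ∧ Q.eval (y : ℤ) < V * t)).filter
          (fun y : ℕ => (Q.eval (y : ℤ) / V).toNat % q = a) =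
        (Finset.range ⌊scale P ρ W N⌋₊).filter fun y : ℕ => y % (V * q) = s ∧
          0 ≤ Q.eval (y : ℤ) ∧ ((Q.eval (y : ℤ) : ℤ) : ℝ) < Λ * u ^ P.natDegree := by
      rw [Finset.filter_filter]
      refine Finset.filter_congr fun y _ => ?_
      rw [huΛ, ← hsy]
      have hcast : ((Q.eval (y : ℤ) : ℤ) : ℝ) < V * t ↔ Q.eval (y : ℤ) < V * t := by
        exact_mod_cast Iff.rfl
      rw [hcast]
      have hrV : (r : ℤ) < V := by exact_mod_cast hr
      have hr0 : (0 : ℤ) ≤ r := Int.natCast_nonneg r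
      constructor
      · rintro ⟨⟨⟨k, hk⟩, h2, h3⟩, h4⟩
        refine ⟨?_, h2, h3⟩
        have hQk : Q.eval (y : ℤ) = r + V * k := by linarith
        have hk0 : 0 ≤ k := by
          by_contra! hneg
          nlinarith
        rw [hQk, Int.add_mul_ediv_left _ _ hV0'.ne', Int.ediv_eq_zero_of_lt hr0 hrV,
          zero_add] at h4
        lift k to ℕ using hk0
        rw [Int.toNat_natCast] at h4
        refine ⟨(k / q : ℕ), ?_⟩
        rw [hQk]
        have := Nat.div_add_mod k q
        rw [h4] at this
        rw [← this, Nat.add_div_of_dvd_right (dvd_mul_right _ _)]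
        rw [Nat.mul_div_cancel_left _ hq0, Nat.div_eq_of_lt ha, add_zero]
        push_cast; ring
      · rintro ⟨⟨k, hk⟩, h2, h3⟩
        have hQk : Q.eval (y : ℤ) = r + V * (q * k + a) := by
          push_cast at hk; linarith
        refine ⟨⟨⟨q * k + a, by linarith⟩, h2, h3⟩, ?_⟩
        rw [hQk, Int.add_mul_ediv_left _ _ hV0'.ne', Int.ediv_eq_zero_of_lt hr0 hrV, zero_add]
        have hk0 : 0 ≤ k := by
          by_contra! hneg
          have hk1 : k + 1 ≤ 0 := hneg
          have h5 : (V : ℤ) * q * (k + 1) ≤ 0 := mul_nonpos_of_nonneg_of_nonpos (by positivity) hk1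
          have h6 : ((V * a + r : ℕ) : ℤ) < ((V * q : ℕ) : ℤ) := by exact_mod_cast hrm
          push_cast at h6
          nlinarith
        lift k to ℕ using hk0
        rw [show (q : ℤ) * k + a = ((q * k + a : ℕ) : ℤ) by push_cast; ring, Int.toNat_natCast,
          Nat.mul_add_mod, Nat.mod_eq_of_lt ha]
    rw [← Finset.sum_filter, hfilter] at hsum
    have hreal : ∑ x ∈ Finset.range t,
        (if x % q = a then nuTilde P ρ W N ((V : ℤ) * x + r) else 0)
        = N / scale P ρ W N * (((Finset.range ⌊scale P ρ W N⌋₊).filter fun y : ℕ =>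
          y % (V * q) = s ∧ 0 ≤ Q.eval (y : ℤ) ∧
            ((Q.eval (y : ℤ) : ℤ) : ℝ) < Λ * u ^ P.natDegree).card : ℝ) := by
      rw [← Complex.ofReal_inj, Complex.ofReal_sum]
      simp only [ite_mul, one_mul, zero_mul, Finset.sum_const, nsmul_eq_mul, mul_one] at hsum
      push_cast at hsum ⊢
      rw [← hsum]
      exact Finset.sum_congr rfl fun x _ => by split_ifs <;> simp
    have hmain : R * (((V : ℝ) * t) ^ p / (V * q))
        = N / scale P ρ W N * (u / ((V * q : ℕ) : ℝ)) := by
      rw [hNM, hu, Real.div_rpow (by positivity) hΛ0.le]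
      have : Λ ^ p ≠ 0 := by positivity
      push_cast
      field_simp
    rw [hreal, hmain, ← mul_sub, abs_mul, abs_of_nonneg (by positivity), mul_comm]
    exact mul_le_mul_of_nonneg_right hcard (by positivity)
  have hfinal : ∑ x ∈ Finset.range t, (if x % q = a then
      ((nuStar P ρ W N ((V : ℤ) * x + r) : ℝ) : ℂ) else 0)
      = ((∑ x ∈ Finset.range t, (if x % q = a then nuTilde P ρ W N ((V : ℤ) * x + r) else 0)
        - ∑ x ∈ Finset.range t, (if x % q = a then nu P.natDegree N ((V : ℤ) * x + r) else 0)
          : ℝ) : ℂ) := by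
    rw [← Finset.sum_sub_distrib, Complex.ofReal_sum]
    refine Finset.sum_congr rfl fun x _ => ?_
    split_ifs
    · rw [nuStar]
    · simp
  rw [hfinal, Complex.norm_real, Real.norm_eq_abs]
  have := abs_sub_le
    (∑ x ∈ Finset.range t, (if x % q = a then nuTilde P ρ W N ((V : ℤ) * x + r) else 0))
    (R * (((V : ℝ) * t) ^ p / (V * q)))
    (∑ x ∈ Finset.range t, (if x % q = a then nu P.natDegree N ((V : ℤ) * x + r) else 0))
  rw [abs_sub_comm (R * _)] at this
  linarith

end Weights

section Estimates

variable {P : ℤ[X]} {ρ : ℤ} {W N B b : ℕ}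

lemma progLength_le {V r : ℕ} (hr : r < V) : (V : ℝ) * progLength N V r ≤ N + V := by
  have h1 := (mul_count_bounds N V r hr).1
  rw [progLength]
  exact_mod_cast h1

/-! ### Major arcs -/

/-- If `θ` is close to a rational whose denominator is composed of primes dividing `W`, then the
sum is negligible: partial summation reduces it to the masses of residue classes. -/
lemma norm_tsum_le_of_smooth_denominator
    (h : IsAdapted (tricked P ρ W) W P.natDegree B b) (hN : 1 ≤ N) {V r q J : ℕ} (hr : r < V)
    (hVN : V ≤ N) (hq : 1 ≤ q) (hVq : V * q ∣ W ^ J) {θ H : ℝ} {a : ℤ}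
    (hθ : |θ - a / q| ≤ H * (V / N)) :
    ‖∑' z : ℤ, e (θ * (z : ℝ)) * ((nuStar P ρ W N ((V : ℤ) * z + r) : ℝ) : ℂ)‖
      ≤ (2 * B + 6) * (N / scale P ρ W N) * (q * (2 + 13 * H)) := by
  have hM := scale_pos h hN
  have hN0 : (0 : ℝ) < N := by exact_mod_cast hN
  have hV0 : 0 < V := by omega
  have hV0' : (0 : ℤ) < V := by exact_mod_cast hV0
  have hV0'' : (0 : ℝ) < V := by exact_mod_cast hV0
  have hrV : (r : ℤ) < V := by exact_mod_cast hr
  have hr0 : (0 : ℤ) ≤ r := Int.natCast_nonneg r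
  have hq0 : (0 : ℝ) < q := by exact_mod_cast hq
  have hNM : 0 ≤ (N : ℝ) / scale P ρ W N := by positivity
  have hH : 0 ≤ H := by
    have : 0 ≤ H * ((V : ℝ) / N) := (abs_nonneg _).trans hθ
    exact nonneg_of_mul_nonneg_left this (by positivity)
  set Q := tricked P ρ W
  set n := progLength N V r with hn
  set η := θ - a / q with hη
  -- terms outside `[0, N)`
  rw [tsum_eq_sub h hN hr]
  set G := (Finset.range ⌊scale P ρ W N⌋₊).filter
        (fun y : ℕ => (V : ℤ) ∣ Q.eval (y : ℤ) - r) with hG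
  rw [← Finset.sum_filter_add_sum_filter_not G
    (fun y : ℕ => 0 ≤ Q.eval (y : ℤ) ∧ Q.eval (y : ℤ) < V * n)]
  have hin : ((N / scale P ρ W N : ℝ) : ℂ) * ∑ y ∈ G.filter
      (fun y : ℕ => 0 ≤ Q.eval (y : ℤ) ∧ Q.eval (y : ℤ) < V * n),
        e (θ * ((Q.eval (y : ℤ) - r) / V : ℤ)) =
      ∑ x ∈ Finset.range n, e (θ * x) * (nuTilde P ρ W N ((V : ℤ) * x + r) : ℂ) := by
    rw [sum_mul_nuTilde h hN hr (fun x => e (θ * x)), hG, Finset.filter_filter]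
    congr 1
    refine Finset.sum_congr rfl fun y hy => ?_
    obtain ⟨-, ⟨k, hk⟩, h2, h3⟩ := Finset.mem_filter.1 hy
    have hQk : Q.eval (y : ℤ) = r + V * k := by linarith
    have hk0 : 0 ≤ k := by
      by_contra! hneg
      nlinarith
    rw [hk, hQk, Int.mul_ediv_cancel_left _ hV0'.ne', Int.add_mul_ediv_left _ _ hV0'.ne',
      Int.ediv_eq_zero_of_lt hr0 hrV, zero_add]
    lift k to ℕ using hk0
    simp
  have hout : ‖∑ y ∈ G.filter
      (fun y : ℕ => ¬ (0 ≤ Q.eval (y : ℤ) ∧ Q.eval (y : ℤ) < V * n)),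
        e (θ * ((Q.eval (y : ℤ) - r) / V : ℤ))‖ ≤ 2 * B := by
    refine (norm_sum_le _ _).trans ?_
    simp only [norm_e, Finset.sum_const, nsmul_eq_mul, mul_one]
    have hsub : G.filter (fun y : ℕ => ¬ (0 ≤ Q.eval (y : ℤ) ∧ Q.eval (y : ℤ) < V * n)) ⊆
        Finset.range B ∪ Finset.Ico (⌊scale P ρ W N⌋₊ - B) ⌊scale P ρ W N⌋₊ := by
      intro y hy
      obtain ⟨hyG, hy2⟩ := Finset.mem_filter.1 hy
      obtain ⟨hy1, k, hk⟩ := Finset.mem_filter.1 hyG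
      rw [Finset.mem_range] at hy1
      rw [Finset.mem_union, Finset.mem_range, Finset.mem_Ico]
      by_contra! hcon
      obtain ⟨hB, hcon⟩ := hcon
      have hy0 := h.eval_nonneg y hB
      have hlt : y + B < ⌊scale P ρ W N⌋₊ := by
        by_contra! hle
        exact absurd hy1 (not_lt.2 (hcon (by omega)))
      have hlt' : (y : ℝ) + B < scale P ρ W N := by
        have h1 : ((y + B : ℕ) : ℝ) < (⌊scale P ρ W N⌋₊ : ℕ) := by exact_mod_cast hlt
        push_cast at h1
        exact h1.trans_le (Nat.floor_le hM.le)
      have h1 := h.eval_lt_of_add_lt hlt'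
      rw [leadingCoeff_mul_scale_pow h] at h1
      have h2 : Q.eval (y : ℤ) < N := by exact_mod_cast h1
      refine hy2 ⟨hy0, ?_⟩
      have hQk : Q.eval (y : ℤ) = r + V * k := by linarith
      have hk0 : 0 ≤ k := by
        by_contra! hneg
        nlinarith
      rw [hQk] at h2 ⊢
      lift k to ℕ using hk0
      have h3 : V * k + r < N := by
        have : (r : ℤ) + V * k < N := h2
        rw [add_comm] at this
        exact_mod_cast this
      have h4 : (k : ℤ) + 1 ≤ n := by exact_mod_cast (lt_progLength_iff hr k).2 h3
      nlinarith
    have hc := (Finset.card_le_card hsub).trans (Finset.card_union_le _ _)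
    rw [Finset.card_range, Nat.card_Ico] at hc
    have : (G.filter (fun y : ℕ => ¬ (0 ≤ Q.eval (y : ℤ) ∧ Q.eval (y : ℤ) < V * n))).card
      ≤ 2 * B := by omega
    exact_mod_cast this
  rw [mul_add, hin]
  -- the remaining terms, by residue classes modulo `q`
  have hclass : ‖∑ x ∈ Finset.range n,
      e (θ * x) * ((nuStar P ρ W N ((V : ℤ) * x + r) : ℝ) : ℂ)‖
      ≤ q * ((2 * B + 6) * (N / scale P ρ W N) * (1 + 13 * H)) := by
    have e1 : ∑ x ∈ Finset.range n, e (θ * x) * ((nuStar P ρ W N ((V : ℤ) * x + r) : ℝ) : ℂ)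
        = ∑ c ∈ Finset.range q, e (a * c / q) * ∑ x ∈ Finset.range n, e (η * x) *
          (if x % q = c then ((nuStar P ρ W N ((V : ℤ) * x + r) : ℝ) : ℂ) else 0) := by
      simp only [Finset.mul_sum]
      rw [Finset.sum_comm]
      refine Finset.sum_congr rfl fun x _ => ?_
      rw [Finset.sum_eq_single_of_mem (x % q) (Finset.mem_range.2 (Nat.mod_lt _ hq)), if_pos rfl,
        ← mul_assoc, ← e_add]
      · congr 1
        obtain ⟨u, hu⟩ : ∃ u, u = x / q := ⟨_, rfl⟩
        have h1 : (x : ℝ) = q * u + (x % q : ℕ) := by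
          rw [hu]; exact_mod_cast (Nat.div_add_mod x q).symm
        have h2 : θ * x = (a * (x % q : ℕ) / q + η * x) + ((a * u : ℤ) : ℝ) := by
          have h3 : (a : ℝ) / q * x = a * (x % q : ℕ) / q + a * u := by
            calc (a : ℝ) / q * x = a / q * (q * u + (x % q : ℕ)) := by rw [← h1]
              _ = _ := by field_simp; ring
          rw [hη]
          push_cast
          linear_combination h3
        rw [h2, e_add_intCast]
      · intro c _ hc
        rw [if_neg hc.symm, mul_zero, mul_zero]
    rw [e1]
    refine (norm_sum_le _ _).trans ?_
    refine (Finset.sum_le_card_nsmul _ _ ((2 * B + 6) * (N / scale P ρ W N) * (1 + 13 * H))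
      fun c hc => ?_).trans_eq ?_
    · rw [norm_mul, norm_e, one_mul]
      refine (norm_sum_mul_le_of_partial_sums (fun x : ℕ => e (η * x)) _ n
        (fun t ht => norm_sum_residue_class_le h hN hr (Finset.mem_range.1 hc) hVq ht)).trans ?_
      refine mul_le_mul_of_nonneg_left ?_ (by positivity)
      rw [norm_e]
      refine add_le_add le_rfl ?_
      have hstep : ∀ x : ℕ, ‖e (η * (x + 1 : ℕ)) - e (η * x)‖ ≤ 2 * Real.pi * |η| := by
        intro x
        have : e (η * (x + 1 : ℕ)) - e (η * x) = e (η * x) * (e η - 1) := by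
          rw [mul_sub, ← e_add, mul_one]; congr 2; push_cast; ring
        rw [this, norm_mul, norm_e, one_mul]
        exact norm_e_sub_one_le η
      refine (Finset.sum_le_card_nsmul _ _ _ fun x _ => hstep x).trans ?_
      rw [Finset.card_range, nsmul_eq_mul]
      have h1 : ((n - 1 : ℕ) : ℝ) ≤ 2 * N / V := by
        rw [le_div_iff₀ hV0'']
        have h2 : ((n - 1 : ℕ) : ℝ) ≤ n := by exact_mod_cast Nat.sub_le n 1
        have h3 := progLength_le (N := N) hr
        rw [← hn] at h3
        have h4 : (V : ℝ) ≤ N := by exact_mod_cast hVN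
        nlinarith
      have hpi : Real.pi ≤ 3.25 := by have := Real.pi_lt_d2; linarith
      calc ((n - 1 : ℕ) : ℝ) * (2 * Real.pi * |η|)
          ≤ (2 * N / V) * (2 * 3.25 * (H * (V / N))) := by gcongr
        _ = 13 * H := by field_simp; ring
    · rw [Finset.card_range, nsmul_eq_mul]
  have hsplit : ∑ x ∈ Finset.range n, e (θ * x) * (nuTilde P ρ W N ((V : ℤ) * x + r) : ℂ) -
      ∑ x ∈ Finset.range n, e (θ * x) * (nu P.natDegree N ((V : ℤ) * x + r) : ℂ) =
      ∑ x ∈ Finset.range n, e (θ * x) * ((nuStar P ρ W N ((V : ℤ) * x + r) : ℝ) : ℂ) := by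
    rw [← Finset.sum_sub_distrib]
    refine Finset.sum_congr rfl fun x _ => ?_
    rw [nuStar]; push_cast; ring
  rw [add_sub_right_comm, hsplit]
  refine (norm_add_le _ _).trans ?_
  rw [norm_mul, Complex.norm_real, Real.norm_of_nonneg hNM]
  have h1 := mul_le_mul_of_nonneg_left hout hNM
  have h2 : (1 : ℝ) ≤ q := by exact_mod_cast hq
  have h3 : (0 : ℝ) ≤ B := Nat.cast_nonneg B
  have h4 : (N : ℝ) / scale P ρ W N * (2 * B) ≤ (2 * B + 6) * (N / scale P ρ W N) * q := by
    calc (N : ℝ) / scale P ρ W N * (2 * B) ≤ (2 * B + 6) * (N / scale P ρ W N) * 1 := by nlinarith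
      _ ≤ _ := mul_le_mul_of_nonneg_left h2 (by positivity)
  calc _ ≤ q * ((2 * B + 6) * (N / scale P ρ W N) * (1 + 13 * H))
        + (2 * B + 6) * (N / scale P ρ W N) * q := add_le_add hclass (h1.trans h4)
    _ = _ := by ring

/-! ### The trivial bound -/

lemma scale_le_rpow (h : IsAdapted (tricked P ρ W) W P.natDegree B b) :
    scale P ρ W N ≤ (N : ℝ) ^ (1 / (P.natDegree : ℝ)) :=
  Real.rpow_le_rpow (div_nonneg (Nat.cast_nonneg _) (by linarith [h.one_le_leadingCoeff]))
    (div_le_self (Nat.cast_nonneg _) h.one_le_leadingCoeff) (by positivity)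

lemma natCast_rpow_split (hN : 1 ≤ N) (p : ℝ) : (N : ℝ) ^ (1 - p) * (N : ℝ) ^ p = N := by
  have hN0 : (0 : ℝ) < N := by exact_mod_cast hN
  rw [← Real.rpow_add hN0, sub_add_cancel, Real.rpow_one]

/-- Choosing a residue class for the arguments of the polynomial. -/
lemma exists_sum_eq_sum_range (h : IsAdapted (tricked P ρ W) W P.natDegree B b) {V r J : ℕ}
    (hV : V ∣ W ^ J) (hM : 0 ≤ scale P ρ W N) (F : ℕ → ℂ) :
    ∃ s n : ℕ, (V : ℝ) * n ≤ scale P ρ W N + V ∧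
      (∀ x : ℕ, (V : ℤ) ∣ (tricked P ρ W).eval (((V * x + s : ℕ) : ℤ)) - r) ∧
      ∑ y ∈ (Finset.range ⌊scale P ρ W N⌋₊).filter
        (fun y : ℕ => (V : ℤ) ∣ (tricked P ρ W).eval (y : ℤ) - r), F y =
        ∑ x ∈ Finset.range n, F (V * x + s) := by
  obtain ⟨s, hs, hsy⟩ := h.exists_residue hV (r : ℤ)
  refine ⟨s, (⌊scale P ρ W N⌋₊ + V - 1 - s) / V, ?_, fun x => ?_, ?_⟩
  · have h1 : (V : ℝ) * ((⌊scale P ρ W N⌋₊ + V - 1 - s) / V : ℕ) ≤ ⌊scale P ρ W N⌋₊ + V := by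
      exact_mod_cast (mul_count_bounds ⌊scale P ρ W N⌋₊ V s hs).1
    have h2 := Nat.floor_le hM
    linarith
  · rw [hsy, Nat.mul_add_mod, Nat.mod_eq_of_lt hs]
  · rw [← sum_filter_mod_eq F _ V s hs]
    congr 1
    exact Finset.filter_congr fun y _ => hsy y

/-- The bound by the total mass of both weights on the progression. -/
lemma norm_tsum_le_trivial (h : IsAdapted (tricked P ρ W) W P.natDegree B b) (hN : 1 ≤ N)
    {V r J : ℕ} (hr : r < V) (hV : V ∣ W ^ J) (hVM : (V : ℝ) ≤ scale P ρ W N)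
    (θ : ℝ) :
    ‖∑' z : ℤ, e (θ * (z : ℝ)) * ((nuStar P ρ W N ((V : ℤ) * z + r) : ℝ) : ℂ)‖
      ≤ 5 * (N / V) := by
  have hM := scale_pos h hN
  have hN0 : (0 : ℝ) < N := by exact_mod_cast hN
  have hV0 : (0 : ℝ) < V := by exact_mod_cast (by omega : 0 < V)
  have hd1 : (1 : ℝ) ≤ P.natDegree := by exact_mod_cast h.one_le_degree
  have hp0 : 0 ≤ 1 / (P.natDegree : ℝ) := by positivity
  have hp1 : 1 / (P.natDegree : ℝ) ≤ 1 := (div_le_one (by linarith)).2 hd1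
  have hMA := scale_le_rpow (N := N) h
  have hsplitN := natCast_rpow_split hN (1 / (P.natDegree : ℝ))
  rw [tsum_eq_sub h hN hr]
  refine (norm_sub_le _ _).trans ?_
  have h1 : ‖((N / scale P ρ W N : ℝ) : ℂ) * ∑ y ∈ (Finset.range ⌊scale P ρ W N⌋₊).filter
        (fun y : ℕ => (V : ℤ) ∣ (tricked P ρ W).eval (y : ℤ) - r),
        e (θ * (((tricked P ρ W).eval (y : ℤ) - r) / V : ℤ))‖ ≤ 2 * (N / V) := by
    obtain ⟨s, n, hn, -, hsum⟩ := exists_sum_eq_sum_range (r := r) h hV hM.le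
      (fun y => e (θ * (((tricked P ρ W).eval (y : ℤ) - r) / V : ℤ)))
    rw [hsum, norm_mul, Complex.norm_real, Real.norm_of_nonneg (by positivity)]
    have h2 : ‖∑ x ∈ Finset.range n,
        e (θ * (((tricked P ρ W).eval ((V * x + s : ℕ) : ℤ) - r) / V : ℤ))‖ ≤ n := by
      refine (norm_sum_le _ _).trans ?_
      simp [norm_e]
    have h3 : (n : ℝ) ≤ 2 * scale P ρ W N / V := by
      rw [le_div_iff₀ hV0]; linarith
    calc _ ≤ (N : ℝ) / scale P ρ W N * (2 * scale P ρ W N / V) := by gcongr; exact h2.trans h3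
      _ = 2 * (N / V) := by field_simp
  have h2 : ‖∑ x ∈ Finset.range (progLength N V r),
        e (θ * x) * (nu P.natDegree N ((V : ℤ) * x + r) : ℂ)‖ ≤ 3 * (N / V) := by
    have hnu : ∀ z, 0 ≤ nu P.natDegree N z := by
      intro z
      rw [nu]
      split_ifs with hz
      · have : (0 : ℝ) ≤ z := by exact_mod_cast hz.1
        positivity
      · exact le_rfl
    have h3 : ‖∑ x ∈ Finset.range (progLength N V r),
        e (θ * x) * (nu P.natDegree N ((V : ℤ) * x + r) : ℂ)‖ ≤
        ∑ x ∈ Finset.range (progLength N V r), nu P.natDegree N ((V : ℤ) * x + r) := by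
      refine (norm_sum_le _ _).trans (Finset.sum_le_sum fun x _ => ?_)
      rw [norm_mul, norm_e, one_mul, Complex.norm_real, Real.norm_of_nonneg (hnu _)]
    have h4 := (abs_le.1 (abs_sum_nu_sub_le (N := N) h.one_le_degree (n := progLength N V r) hr
      fun x hx => (lt_progLength_iff hr x).1 hx)).2
    refine h3.trans ?_
    set p := 1 / (P.natDegree : ℝ)
    set R := (N : ℝ) ^ (1 - p)
    have hR0 : 0 ≤ R := by positivity
    have hV1 : (1 : ℝ) ≤ V := by exact_mod_cast (by omega : 1 ≤ V)
    have h5 : ((V : ℝ) * progLength N V r) ^ p ≤ (N : ℝ) ^ p + V :=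
      rpow_le_rpow_add hp0 hp1 (by positivity) hN0.le hV1 (progLength_le hr)
    have h6 : ((V : ℝ) * progLength N V r) ^ p / V ≤ (N : ℝ) ^ p / V + 1 := by
      rw [div_add_one hV0.ne']; gcongr
    have h7 := mul_le_mul_of_nonneg_left h6 hR0
    have h8 : R * ((N : ℝ) ^ p / V) = N / V := by rw [← mul_div_assoc, hsplitN]
    have h9 : R ≤ N / V := by
      rw [le_div_iff₀ hV0, ← hsplitN]
      exact mul_le_mul_of_nonneg_left (hVM.trans hMA) hR0
    linarith
  linarith

/-! ### Large sums force `θ` to be close to a rational -/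

/-- A large exponential sum over the values of the polynomial in a progression: on the residue class
where `V` divides `P̃(y) - r`, the phase is a polynomial in `x = ⌊y / V⌋` with leading coefficient
`θ b W ^ (d - 1) V ^ (d - 1)`, to which Weyl's inequality applies. -/
lemma exists_denominator_of_large_polynomial_sum {d : ℕ} (hd : 1 ≤ d) : ∃ K : ℕ,
    ∀ {P : ℤ[X]} {ρ : ℤ} {W N B b V r J T : ℕ},
    P.natDegree = d → IsAdapted (tricked P ρ W) W P.natDegree B b → 1 ≤ N → r < V → V ∣ W ^ J →
    (V : ℝ) ≤ scale P ρ W N → 2 ≤ T → ∀ θ : ℝ,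
    (N : ℝ) / (2 * V * T) ≤ ‖((N / scale P ρ W N : ℝ) : ℂ) *
      ∑ y ∈ (Finset.range ⌊scale P ρ W N⌋₊).filter
        (fun y : ℕ => (V : ℤ) ∣ (tricked P ρ W).eval (y : ℤ) - r),
        e (θ * (((tricked P ρ W).eval (y : ℤ) - r) / V : ℤ))‖ →
    ∃ q : ℕ, 1 ≤ q ∧ q ≤ T ^ K ∧ ∃ a : ℤ,
      |θ - a / (q * (b * W ^ (d - 1) * V ^ (d - 1)) : ℕ)| ≤ (T : ℝ) ^ K * (V / N) := by
  obtain ⟨k, rfl⟩ : ∃ k, d = k + 1 := ⟨d - 1, by omega⟩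
  obtain ⟨K, hK⟩ := exists_denominator_of_large_weyl_sum k
  refine ⟨3 * K + 2 * (k + 1), ?_⟩
  intro P ρ W N B b V r J T hPd h hN hr hV hVM hT θ hS
  have hM := scale_pos h hN
  have hN0 : (0 : ℝ) < N := by exact_mod_cast hN
  have hV0 : 0 < V := by omega
  have hV0' : (0 : ℝ) < V := by exact_mod_cast hV0
  have hT2 : (2 : ℝ) ≤ T := by exact_mod_cast hT
  have hT0 : (0 : ℝ) < T := by linarith
  have hΛ := h.one_le_leadingCoeff
  set M := scale P ρ W N with hMdef
  set Q := tricked P ρ W with hQ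
  obtain ⟨s, n, hn, hdvd, hsum⟩ := exists_sum_eq_sum_range (r := r) h hV hM.le
    (fun y => e (θ * ((Q.eval (y : ℤ) - r) / V : ℤ)))
  rw [hsum, norm_mul, Complex.norm_real, Real.norm_of_nonneg (by positivity)] at hS
  set g : ℝ[X] := (Q.map (Int.castRingHom ℝ)).comp (C (V : ℝ) * X + C (s : ℝ)) with hg
  set f : ℝ[X] := C (θ / V) * (g - C (r : ℝ)) with hf
  have hmapdeg : (Q.map (Int.castRingHom ℝ)).natDegree = k + 1 := by
    rw [natDegree_map_eq_of_injective (RingHom.injective_int _), h.natDegree_eq, hPd]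
  have hgdeg : g.natDegree = k + 1 := by
    rw [hg, natDegree_comp, natDegree_linear hV0'.ne', mul_one, hmapdeg]
  have hgcoeff : g.coeff (k + 1) = Q.leadingCoeff * (V : ℝ) ^ (k + 1) := by
    have h1 := coeff_comp_degree_mul_degree (p := Q.map (Int.castRingHom ℝ))
      (q := C (V : ℝ) * X + C (s : ℝ)) (by rw [natDegree_linear hV0'.ne']; exact one_ne_zero)
    rw [natDegree_linear hV0'.ne', mul_one, hmapdeg, leadingCoeff_linear hV0'.ne',
      leadingCoeff_map_of_injective (RingHom.injective_int _)] at h1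
    rw [eq_intCast] at h1
    exact h1
  have hfdeg : f.natDegree ≤ k + 1 := by
    rw [hf]
    refine (natDegree_C_mul_le _ _).trans ((natDegree_sub_le _ _).trans ?_)
    rw [hgdeg, natDegree_C]; simp
  have hfcoeff : f.coeff (k + 1) = θ * (Q.leadingCoeff * (V : ℝ) ^ k) := by
    rw [hf, coeff_C_mul, coeff_sub, hgcoeff, coeff_C_succ, sub_zero]
    field_simp
    ring
  have hfeval : ∀ x : ℕ, e (θ * ((Q.eval ((V * x + s : ℕ) : ℤ) - r) / V : ℤ))
      = e (f.eval (x : ℝ)) := by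
    intro x
    congr 1
    rw [hf, eval_mul, eval_C, eval_sub, eval_C, hg, eval_comp, eval_add, eval_mul, eval_C, eval_X,
      eval_C]
    have h1 : (Q.map (Int.castRingHom ℝ)).eval ((V : ℝ) * x + s)
        = ((Q.eval ((V * x + s : ℕ) : ℤ) : ℤ) : ℝ) := by
      have h2 := eval_intCast_map (Int.castRingHom ℝ) Q ((V * x + s : ℕ) : ℤ)
      push_cast at h2 ⊢
      exact h2
    rw [h1, Int.cast_div (hdvd x) (by exact_mod_cast hV0'.ne')]
    push_cast
    ring
  simp only [hfeval] at hS
  set S := ‖∑ x ∈ Finset.range n, e (f.eval (x : ℝ))‖ with hSdef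
  have hS' : M ≤ 2 * V * T * S := by
    rw [div_le_iff₀ (by positivity)] at hS
    have h1 : (N : ℝ) / M * S * (2 * V * T) = N * (2 * V * T * S) / M := by ring
    rw [h1, le_div_iff₀ hM] at hS
    exact le_of_mul_le_mul_left hS hN0
  have hSn : S ≤ n := by
    refine (norm_sum_le _ _).trans ?_
    simp [norm_e]
  have hMn : M ≤ 2 * T * (V * n) := by
    calc M ≤ 2 * V * T * S := hS'
      _ ≤ 2 * V * T * n := by gcongr
      _ = _ := by ring
  have hn1 : 1 ≤ n := by
    by_contra! hlt
    have : n = 0 := by omega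
    rw [this] at hMn
    simp only [Nat.cast_zero, mul_zero] at hMn
    linarith
  have hnS : (n : ℝ) ≤ (T ^ 3 : ℕ) * S := by
    have h1 : (V : ℝ) * n ≤ V * (4 * T * S) := by linarith
    have h2 := le_of_mul_le_mul_left h1 hV0'
    have h3 : (4 : ℝ) * T ≤ (T ^ 3 : ℕ) := by
      push_cast
      nlinarith [mul_le_mul hT2 hT2 (by norm_num) hT0.le]
    exact h2.trans (mul_le_mul_of_nonneg_right h3 (norm_nonneg _))
  have hT3 : 2 ≤ T ^ 3 := by
    calc 2 ≤ 2 ^ 3 := by norm_num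
      _ ≤ T ^ 3 := Nat.pow_le_pow_left hT 3
  obtain ⟨q, hq1, hq2, a, ha⟩ := hK f n (T ^ 3) hT3 hfdeg hn1 hnS
  have hq0 : (0 : ℝ) < q := by exact_mod_cast hq1
  refine ⟨q, hq1, hq2.trans ?_, a, ?_⟩
  · rw [← pow_mul]; exact Nat.pow_le_pow_right (by omega) (by omega)
  rw [hfcoeff] at ha
  have hΛL : (Q.leadingCoeff : ℝ) = b * (W : ℝ) ^ k := by
    rw [h.leadingCoeff_eq, hPd]; push_cast; rfl
  set Λ : ℝ := (Q.leadingCoeff : ℝ) with hΛdef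
  have hden : ((q * (b * W ^ (k + 1 - 1) * V ^ (k + 1 - 1)) : ℕ) : ℝ) = q * (Λ * V ^ k) := by
    rw [hΛL]; push_cast [Nat.add_sub_cancel]; ring
  rw [hden]
  have hΛ0 : 0 < Λ := by linarith
  have hD0 : 0 < q * (Λ * (V : ℝ) ^ k) := by positivity
  have hNV : (N : ℝ) / V = (Λ * V ^ k) * (M / V) ^ (k + 1) := by
    have h1 : Λ * M ^ (k + 1) = N := by
      have := leadingCoeff_mul_scale_pow (N := N) h
      rwa [hPd] at this
    rw [← h1, div_pow, pow_succ (V : ℝ)]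
    field_simp
  have hMV : (M / V) ^ (k + 1) ≤ (2 * T) ^ (k + 1) * (n : ℝ) ^ (k + 1) := by
    rw [← mul_pow]
    refine pow_le_pow_left₀ (by positivity) ?_ _
    rw [div_le_iff₀ hV0']
    linarith
  have e1 : |(q : ℝ) * (θ * (Λ * V ^ k)) - a|
      = |θ - a / (q * (Λ * V ^ k))| * (q * (Λ * V ^ k)) := by
    rw [← abs_of_pos hD0, ← abs_mul, abs_of_pos hD0]
    congr 1
    field_simp
  rw [e1] at ha
  rw [← one_div_div (N : ℝ) V, mul_one_div, le_div_iff₀ (by positivity), hNV]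
  have hq1' : (1 : ℝ) ≤ q := by exact_mod_cast hq1
  set x := |θ - a / (q * (Λ * V ^ k))| with hx
  have hx0 : 0 ≤ x := abs_nonneg _
  calc x * (Λ * V ^ k * (M / V) ^ (k + 1))
      ≤ x * (Λ * V ^ k * ((2 * T) ^ (k + 1) * (n : ℝ) ^ (k + 1))) := by gcongr
    _ = (2 * T) ^ (k + 1) * (x * (1 * (Λ * V ^ k)) * (n : ℝ) ^ (k + 1)) := by ring
    _ ≤ (2 * T) ^ (k + 1) * (x * (q * (Λ * V ^ k)) * (n : ℝ) ^ (k + 1)) := by gcongr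
    _ ≤ ((T : ℝ) ^ 2) ^ (k + 1) * ((T ^ 3 : ℕ) : ℝ) ^ K := by
      refine mul_le_mul ?_ ha (by positivity) (by positivity)
      exact pow_le_pow_left₀ (by positivity) (by nlinarith) _
    _ = (T : ℝ) ^ (3 * K + 2 * (k + 1)) := by push_cast; ring

end Estimates

section Inverse

variable {P : ℤ[X]} {ρ : ℤ} {W N B b : ℕ}

/-- An exponential sum against a decreasing weight is controlled by the first weight and the
distance from the frequency to the nearest integer. -/
lemma norm_sum_antitone_mul_le (v : ℕ → ℝ) (hv : Antitone v) (hv0 : ∀ x, 0 ≤ v x) (θ : ℝ)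
    (m n : ℕ) :
    ‖∑ x ∈ Finset.range n, e (θ * (m + x : ℕ)) * (v (m + x) : ℂ)‖ * (2 * |θ - round θ|) ≤ v m := by
  set β := |θ - round θ| with hβ
  rcases (abs_nonneg (θ - round θ)).eq_or_lt with h0 | h0
  · rw [hβ, ← h0]; simpa using hv0 m
  rw [← hβ] at h0
  have hpart : ∀ t ≤ n, ‖∑ x ∈ Finset.range t, e (θ * (m + x : ℕ))‖ ≤ 1 / (2 * β) := by
    intro t _
    rw [le_div_iff₀ (by positivity)]
    have h1 : ∑ x ∈ Finset.range t, e (θ * (m + x : ℕ))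
        = e (θ * m) * ∑ x ∈ Finset.range t, e (θ * x) := by
      rw [Finset.mul_sum]
      refine Finset.sum_congr rfl fun x _ => ?_
      rw [← e_add]; congr 1; push_cast; ring
    rw [h1, norm_mul, norm_e, one_mul]
    exact norm_sum_e_mul_le θ t
  have h1 := norm_sum_mul_le_of_partial_sums (fun x : ℕ => (v (m + x) : ℂ)) _ n hpart
  have h2 : ‖(v (m + (n - 1)) : ℂ)‖ + ∑ x ∈ Finset.range (n - 1),
      ‖(v (m + (x + 1)) : ℂ) - (v (m + x) : ℂ)‖ = v m := by
    have h3 : ∀ x : ℕ, ‖(v (m + (x + 1)) : ℂ) - (v (m + x) : ℂ)‖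
        = v (m + x) - v (m + (x + 1)) := by
      intro x
      rw [← Complex.ofReal_sub, Complex.norm_real, Real.norm_eq_abs, abs_sub_comm,
        abs_of_nonneg (sub_nonneg.2 (hv (by omega)))]
    simp only [h3]
    rw [Finset.sum_range_sub' (fun x => v (m + x)), Complex.norm_real,
      Real.norm_of_nonneg (hv0 _), add_zero]
    ring
  rw [h2] at h1
  have h3 : ∑ x ∈ Finset.range n, e (θ * (m + x : ℕ)) * (v (m + x) : ℂ)
      = ∑ x ∈ Finset.range n, (v (m + x) : ℂ) * e (θ * (m + x : ℕ)) :=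
    Finset.sum_congr rfl fun x _ => mul_comm _ _
  rw [h3]
  calc _ ≤ 1 / (2 * β) * v m * (2 * β) := by gcongr
    _ = v m := by field_simp

/-- A large exponential sum against `ν` has a frequency very close to an integer. -/
lemma abs_sub_round_le_of_large_smooth_sum (hN : 1 ≤ N) {d V r T : ℕ} (hd : 1 ≤ d) (hr : r < V)
    (hT : 2 ≤ T) (hVN : 16 * (T : ℝ) * V ≤ (N : ℝ) ^ (1 / (d : ℝ))) (θ : ℝ)
    (hS : (N : ℝ) / (2 * V * T) ≤ ‖∑ x ∈ Finset.range (progLength N V r),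
        e (θ * x) * (nu d N ((V : ℤ) * x + r) : ℂ)‖) :
    |θ - round θ| ≤ (T : ℝ) ^ (2 + 4 * d) * (V / N) := by
  have hN0 : (0 : ℝ) < N := by exact_mod_cast hN
  have hV0 : (0 : ℝ) < V := by exact_mod_cast (by omega : 0 < V)
  have hV1 : (1 : ℝ) ≤ V := by exact_mod_cast (by omega : 1 ≤ V)
  have hT2 : (2 : ℝ) ≤ T := by exact_mod_cast hT
  have hT0 : (0 : ℝ) < T := by linarith
  have hd1 : (1 : ℝ) ≤ d := by exact_mod_cast hd
  set p : ℝ := 1 / (d : ℝ) with hp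
  have hp0 : 0 < p := by positivity
  have hp1 : p ≤ 1 := (div_le_one (by linarith)).2 hd1
  set R : ℝ := (N : ℝ) ^ (1 - p) with hR
  have hR0 : 0 < R := Real.rpow_pos_of_pos hN0 _
  have hsplitN : R * (N : ℝ) ^ p = N := natCast_rpow_split hN p
  set n := progLength N V r with hn
  -- the weight is at most `κ` from `N / κ` on, and the terms below `N / κ` are negligible
  set κ : ℝ := (8 * T : ℝ) ^ d with hκ
  have hκ1 : 1 ≤ κ := one_le_pow₀ (by linarith)
  have hκ0 : 0 < κ := by linarith
  have hκp : κ ^ p = 8 * T := by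
    rw [hκ, hp, one_div, Real.pow_rpow_inv_natCast (by positivity) (by omega)]
  set n₀ := ⌈(N : ℝ) / (V * κ)⌉₊ with hn₀
  set v : ℕ → ℝ := fun x => R * (p * ((V : ℝ) * x + r + 1) ^ (p - 1)) with hv
  have hv0 : ∀ x, 0 ≤ v x := fun x => by positivity
  have hvanti : Antitone v := by
    intro x y hxy
    have hxy' : (x : ℝ) ≤ y := by exact_mod_cast hxy
    have : ((V : ℝ) * y + r + 1) ^ (p - 1) ≤ ((V : ℝ) * x + r + 1) ^ (p - 1) :=
      Real.rpow_le_rpow_of_nonpos (by positivity) (by gcongr) (by linarith)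
    simp only [hv]
    gcongr
  have hvn₀ : v n₀ ≤ κ := by
    have h1 : (N : ℝ) / κ ≤ (V : ℝ) * n₀ + r + 1 := by
      have h2 := Nat.le_ceil ((N : ℝ) / (V * κ))
      rw [← hn₀, div_le_iff₀ (by positivity)] at h2
      rw [div_le_iff₀ hκ0]
      have h3 : (0 : ℝ) ≤ (r + 1) * κ := by positivity
      nlinarith
    have h2 : ((V : ℝ) * n₀ + r + 1) ^ (p - 1) ≤ ((N : ℝ) / κ) ^ (p - 1) :=
      Real.rpow_le_rpow_of_nonpos (by positivity) h1 (by linarith)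
    have h3 : R * ((N : ℝ) / κ) ^ (p - 1) = κ ^ (1 - p) := by
      rw [hR, Real.div_rpow hN0.le hκ0.le, show p - 1 = -(1 - p) by ring, Real.rpow_neg hN0.le,
        Real.rpow_neg hκ0.le]
      have : (N : ℝ) ^ (1 - p) ≠ 0 := hR0.ne'
      field_simp
    calc v n₀ ≤ R * (1 * ((N : ℝ) / κ) ^ (p - 1)) := by simp only [hv]; gcongr
      _ = κ ^ (1 - p) := by rw [one_mul, h3]
      _ ≤ κ ^ (1 : ℝ) := Real.rpow_le_rpow_of_exponent_le hκ1 (by linarith)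
      _ = κ := Real.rpow_one κ
  have hveq : ∀ x < n, nu d N ((V : ℤ) * x + r) = v x := by
    intro x hx
    have := nu_natCast_of_lt (N := N) hd ((lt_progLength_iff hr x).1 hx)
    push_cast at this
    exact this
  set n₁ := min n₀ n with hn₁
  obtain ⟨k, hk⟩ : ∃ k, n = n₁ + k := ⟨n - n₁, by omega⟩
  have hsum : ∑ x ∈ Finset.range n, e (θ * x) * (nu d N ((V : ℤ) * x + r) : ℂ)
      = ∑ x ∈ Finset.range n₁, e (θ * x) * (v x : ℂ)
        + ∑ x ∈ Finset.range k, e (θ * (n₁ + x : ℕ)) * (v (n₁ + x) : ℂ) := by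
    rw [← Finset.sum_range_add (fun x : ℕ => e (θ * x) * (v x : ℂ)), ← hk]
    refine Finset.sum_congr rfl fun x hx => ?_
    rw [hveq x (Finset.mem_range.1 hx)]
  rw [hsum] at hS
  have hhead : ‖∑ x ∈ Finset.range n₁, e (θ * x) * (v x : ℂ)‖ ≤ N / (4 * V * T) := by
    have h1 : ‖∑ x ∈ Finset.range n₁, e (θ * x) * (v x : ℂ)‖ ≤ ∑ x ∈ Finset.range n₁, v x := by
      refine (norm_sum_le _ _).trans (Finset.sum_le_sum fun x _ => ?_)
      rw [norm_mul, norm_e, one_mul, Complex.norm_real, Real.norm_of_nonneg (hv0 x)]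
    have h2 : ∑ x ∈ Finset.range n₁, v x ≤ R * (((V : ℝ) * n₁) ^ p / V + 1) := by
      simp only [hv]
      rw [← Finset.mul_sum]
      exact mul_le_mul_of_nonneg_left (sum_density_le hp0.le hp1 hr n₁) hR0.le
    have h3 : ((V : ℝ) * n₁) ^ p ≤ ((N : ℝ) / κ) ^ p + V := by
      refine rpow_le_rpow_add hp0.le hp1 (by positivity) (by positivity) hV1 ?_
      have h4 : (n₁ : ℝ) ≤ N / (V * κ) + 1 := by
        have h5 : (n₁ : ℝ) ≤ n₀ := by exact_mod_cast min_le_left _ _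
        exact h5.trans (Nat.ceil_lt_add_one (by positivity)).le
      calc (V : ℝ) * n₁ ≤ V * (N / (V * κ) + 1) := by gcongr
        _ = N / κ + V := by field_simp
    have h4 : ((N : ℝ) / κ) ^ p = (N : ℝ) ^ p / (8 * T) := by
      rw [Real.div_rpow hN0.le hκ0.le, hκp]
    rw [h4] at h3
    have h5 : ((V : ℝ) * n₁) ^ p / V + 1 ≤ (N : ℝ) ^ p / (8 * T) / V + 2 := by
      have : ((V : ℝ) * n₁) ^ p / V ≤ ((N : ℝ) ^ p / (8 * T) + V) / V := by gcongr
      rw [add_div, div_self hV0.ne'] at this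
      linarith
    have h6 : (2 : ℝ) ≤ (N : ℝ) ^ p / (8 * T) / V := by
      rw [div_div, le_div_iff₀ (by positivity)]; linarith
    calc _ ≤ R * (((V : ℝ) * n₁) ^ p / V + 1) := h1.trans h2
      _ ≤ R * ((N : ℝ) ^ p / (8 * T) / V + (N : ℝ) ^ p / (8 * T) / V) := by
        exact mul_le_mul_of_nonneg_left (by linarith) hR0.le
      _ = (R * (N : ℝ) ^ p) / (4 * V * T) := by field_simp; norm_num
      _ = _ := by rw [hsplitN]
  have htail : (N : ℝ) / (4 * V * T) ≤
      ‖∑ x ∈ Finset.range k, e (θ * (n₁ + x : ℕ)) * (v (n₁ + x) : ℂ)‖ := by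
    have h1 := hS.trans (norm_add_le _ _)
    have h2 : (N : ℝ) / (2 * V * T) = N / (4 * V * T) + N / (4 * V * T) := by field_simp; norm_num
    linarith
  have hpos : 0 < (N : ℝ) / (4 * V * T) := by positivity
  have hk0 : 0 < k := by
    by_contra! hle
    have : k = 0 := by omega
    rw [this] at htail
    simp at htail
    linarith
  have hn₁eq : n₁ = n₀ := by omega
  have h1 := norm_sum_antitone_mul_le v hvanti hv0 θ n₁ k
  rw [hn₁eq] at h1 htail
  have h2 : (N : ℝ) / (4 * V * T) * (2 * |θ - round θ|) ≤ κ :=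
    (mul_le_mul_of_nonneg_right htail (by positivity)).trans (h1.trans hvn₀)
  have h3 : |θ - round θ| ≤ 2 * T * κ * (V / N) := by
    have h4 : |θ - round θ| = (N : ℝ) / (4 * V * T) * (2 * |θ - round θ|) * (2 * T * (V / N)) := by
      field_simp; norm_num
    rw [h4]
    calc _ ≤ κ * (2 * T * (V / N)) := by gcongr
      _ = _ := by ring
  refine h3.trans (mul_le_mul_of_nonneg_right ?_ (by positivity))
  calc 2 * T * κ ≤ T * T * ((T : ℝ) ^ 4) ^ d := by
        rw [hκ]
        gcongr
        calc (8 : ℝ) * T = 2 ^ 3 * T := by norm_num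
          _ ≤ (T : ℝ) ^ 3 * T := by gcongr
          _ = _ := by ring
    _ = (T : ℝ) ^ (2 + 4 * d) := by ring

/-- If the sum in question is at least `N / (V T)`, then `θ` has a rational approximation whose
denominator is the product of a number at most `T ^ K` and of primes dividing `b W`. -/
lemma exists_denominator_of_large_tsum {d : ℕ} (hd : 1 ≤ d) : ∃ K : ℕ,
    ∀ {P : ℤ[X]} {ρ : ℤ} {W N B b V r J T : ℕ},
    P.natDegree = d → IsAdapted (tricked P ρ W) W P.natDegree B b → 1 ≤ N → r < V → V ∣ W ^ J →
    2 ≤ T → 16 * (T : ℝ) * V ≤ scale P ρ W N → ∀ θ : ℝ,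
    (N : ℝ) / (V * T) ≤ ‖∑' z : ℤ, e (θ * (z : ℝ)) *
      ((nuStar P ρ W N ((V : ℤ) * z + r) : ℝ) : ℂ)‖ →
    ∃ q : ℕ, 1 ≤ q ∧ q ≤ T ^ K ∧ ∃ a : ℤ,
      |θ - a / (q * (b * W ^ (d - 1) * V ^ (d - 1)) : ℕ)| ≤ (T : ℝ) ^ K * (V / N) := by
  obtain ⟨K, hK⟩ := exists_denominator_of_large_polynomial_sum hd
  refine ⟨K + (2 + 4 * d), ?_⟩
  intro P ρ W N B b V r J T hPd h hN hr hV hT hVM θ hS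
  have hT1 : 1 ≤ T := by omega
  have hT1' : (1 : ℝ) ≤ T := by exact_mod_cast hT1
  have hV0 : 0 < V := by omega
  have hV0' : (0 : ℝ) < V := by exact_mod_cast hV0
  have hVM' : (V : ℝ) ≤ scale P ρ W N := by nlinarith
  rw [tsum_eq_sub h hN hr] at hS
  have hS' := hS.trans (norm_sub_le _ _)
  have h2 : (N : ℝ) / (V * T) = N / (2 * V * T) + N / (2 * V * T) := by field_simp; norm_num
  rcases le_or_gt ((N : ℝ) / (2 * V * T)) ‖((N / scale P ρ W N : ℝ) : ℂ) *
      ∑ y ∈ (Finset.range ⌊scale P ρ W N⌋₊).filter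
        (fun y : ℕ => (V : ℤ) ∣ (tricked P ρ W).eval (y : ℤ) - r),
        e (θ * (((tricked P ρ W).eval (y : ℤ) - r) / V : ℤ))‖ with hlarge | hsmall
  · obtain ⟨q, hq1, hq2, a, ha⟩ := hK hPd h hN hr hV hVM' hT θ hlarge
    refine ⟨q, hq1, hq2.trans (Nat.pow_le_pow_right hT1 (by omega)), a, ha.trans ?_⟩
    exact mul_le_mul_of_nonneg_right (pow_le_pow_right₀ hT1' (by omega)) (by positivity)
  · have h3 : 16 * (T : ℝ) * V ≤ (N : ℝ) ^ (1 / (P.natDegree : ℝ)) :=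
      hVM.trans (scale_le_rpow h)
    have h4 := abs_sub_round_le_of_large_smooth_sum hN h.one_le_degree hr hT h3 θ (by linarith)
    have hL0 : 0 < b * W ^ (d - 1) * V ^ (d - 1) := by
      have := h.one_le_b
      have := h.two_le_W
      positivity
    refine ⟨1, le_rfl, Nat.one_le_pow _ _ hT1,
      round θ * (b * W ^ (d - 1) * V ^ (d - 1) : ℕ), ?_⟩
    have hL0' : ((b * W ^ (d - 1) * V ^ (d - 1) : ℕ) : ℝ) ≠ 0 := by exact_mod_cast hL0.ne'
    rw [one_mul, Int.cast_mul, Int.cast_natCast, mul_div_cancel_right₀ _ hL0']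
    refine h4.trans ?_
    rw [hPd]
    exact mul_le_mul_of_nonneg_right (pow_le_pow_right₀ hT1' (by omega)) (by positivity)

end Inverse

/-! ### The tricked polynomial is adapted to `W` -/

lemma coeff_tricked (P : ℤ[X]) (ρ : ℤ) (W n : ℕ) :
    (tricked P ρ W).coeff n = (if n = 1 then 1 else 0) +
      if n ∈ Finset.Icc 2 P.natDegree then beta P ρ n * beta P ρ 1 ^ (n - 2) * (W : ℤ) ^ (n - 1)
      else 0 := by
  rw [tricked, coeff_add, coeff_X, finsetSum_coeff]
  congr 1
  · simp only [eq_comm]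
  · simp only [coeff_C_mul, coeff_X_pow, mul_ite, mul_one, mul_zero]
    rw [Finset.sum_ite_eq]

lemma eval_tricked (P : ℤ[X]) (ρ : ℤ) (W : ℕ) (x : ℤ) :
    (tricked P ρ W).eval x = x + ∑ i ∈ Finset.Icc 2 P.natDegree,
      beta P ρ i * beta P ρ 1 ^ (i - 2) * (W : ℤ) ^ (i - 1) * x ^ i := by
  simp [tricked, eval_finsetSum]

/-- All terms of degree at least `2` have coefficients divisible by `W`. -/
lemma tricked_unit_slope (P : ℤ[X]) (ρ : ℤ) (W : ℕ) (x y : ℤ) :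
    ∃ k : ℤ, (tricked P ρ W).eval x - (tricked P ρ W).eval y = (x - y) * (1 + W * k) := by
  have hdvd : (x - y) * W ∣ ∑ i ∈ Finset.Icc 2 P.natDegree,
      beta P ρ i * beta P ρ 1 ^ (i - 2) * (W : ℤ) ^ (i - 1) * (x ^ i - y ^ i) := by
    refine Finset.dvd_sum fun i hi => ?_
    have h2 := (Finset.mem_Icc.1 hi).1
    have h3 : (W : ℤ) ∣ (W : ℤ) ^ (i - 1) := dvd_pow_self _ (by omega)
    rw [mul_comm (x - y)]
    exact mul_dvd_mul (h3.mul_left _) (sub_dvd_pow_sub_pow x y i)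
  obtain ⟨k, hk⟩ := hdvd
  refine ⟨k, ?_⟩
  have h1 : (x - y) * (1 + W * k) = (x - y) + (x - y) * W * k := by ring
  rw [h1, ← hk, eval_tricked, eval_tricked]
  simp only [mul_sub, Finset.sum_sub_distrib]
  ring

lemma one_le_natDegree_of_rootMultiplicity {P : ℤ[X]} {ρ : ℤ} (hρ : P.rootMultiplicity ρ = 1) :
    1 ≤ P.natDegree := by
  rw [← hρ, ← count_roots]
  exact (Multiset.count_le_card _ _).trans (card_roots' P)

lemma beta_natDegree (P : ℤ[X]) (ρ : ℤ) : beta P ρ P.natDegree = P.leadingCoeff := by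
  have h := coeff_comp_degree_mul_degree (p := P) (q := X + C ρ)
    (by rw [natDegree_X_add_C]; exact one_ne_zero)
  rw [natDegree_X_add_C, mul_one, leadingCoeff_X_add_C, one_pow, mul_one] at h
  exact h

theorem exists_isAdapted_tricked (P : ℤ[X]) (ρ : ℤ) (hρ : P.rootMultiplicity ρ = 1)
    (hpos : 0 < P.leadingCoeff * beta P ρ 1 ^ P.natDegree) :
    ∃ B b : ℕ, ∀ W : ℕ, 2 ≤ W → IsAdapted (tricked P ρ W) W P.natDegree B b := by
  have hd := one_le_natDegree_of_rootMultiplicity hρ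
  set d := P.natDegree with hdef
  rcases hd.eq_or_lt with hd1 | hd2
  · refine ⟨0, 1, fun W hW => ?_⟩
    have hX : tricked P ρ W = X := by
      rw [tricked, ← hdef, ← hd1]; simp
    refine ⟨hd, ?_, ?_, le_rfl, hW, tricked_unit_slope P ρ W, fun y => ?_⟩
    · rw [hX, natDegree_X, hd1]
    · rw [hX, leadingCoeff_X, ← hd1]; simp
    · rw [hX, ← hd1]; simp
  -- the exponent of `β₁` may be lowered by two without changing the sign
  have hγ : 0 < beta P ρ d * beta P ρ 1 ^ (d - 2) := by
    rw [hdef, beta_natDegree, ← hdef]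
    obtain ⟨k, hk⟩ : ∃ k, d = k + 2 := ⟨d - 2, by omega⟩
    rw [hk] at hpos ⊢
    rw [Nat.add_sub_cancel]
    rw [pow_add, ← mul_assoc] at hpos
    exact pos_of_mul_pos_left hpos (sq_nonneg _)
  obtain ⟨b, hb⟩ := Int.eq_ofNat_of_zero_le hγ.le
  set Bz : ℕ := 1 + ∑ i ∈ Finset.Ico 2 d, (beta P ρ i * beta P ρ 1 ^ (i - 2)).natAbs with hBz
  have hb1 : 1 ≤ b := by omega
  refine ⟨Bz, b, fun W hW => ?_⟩
  have hcoeff : (tricked P ρ W).coeff d = b * (W : ℤ) ^ (d - 1) := by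
    rw [coeff_tricked, if_neg (by omega), if_pos (Finset.mem_Icc.2 ⟨hd2, le_rfl⟩), hb, zero_add]
  have hΛ1 : 1 ≤ b * W ^ (d - 1) := Nat.mul_pos hb1 (Nat.pow_pos (by omega))
  have hdeg : (tricked P ρ W).natDegree = d := by
    refine natDegree_eq_of_le_of_coeff_ne_zero ?_ ?_
    · rw [natDegree_le_iff_coeff_eq_zero]
      intro n hn
      rw [coeff_tricked, if_neg (by omega), if_neg (fun h => by
        have := (Finset.mem_Icc.1 h).2; omega), zero_add]
    · rw [hcoeff]
      exact_mod_cast (by omega : b * W ^ (d - 1) ≠ 0)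
  have hlead : (tricked P ρ W).leadingCoeff = b * (W : ℤ) ^ (d - 1) := by
    rw [leadingCoeff, hdeg, hcoeff]
  refine ⟨hd, hdeg, hlead, hb1, hW, tricked_unit_slope P ρ W, fun y => ?_⟩
  have hint : |(tricked P ρ W).eval (y : ℤ) - b * (W : ℤ) ^ (d - 1) * (y : ℤ) ^ d|
      ≤ Bz * (b * (W : ℤ) ^ (d - 1)) * (y : ℤ) ^ (d - 1) := by
    have hpow : ∀ i, 1 ≤ i → i ≤ d - 1 → (y : ℤ) ^ i ≤ (y : ℤ) ^ (d - 1) := by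
      intro i hi hid
      rcases Nat.eq_zero_or_pos y with rfl | hy
      · rw [Nat.cast_zero, zero_pow (by omega), zero_pow (by omega)]
      · exact_mod_cast Nat.pow_le_pow_right hy hid
    have hWpow : ∀ i, i ≤ d → (W : ℤ) ^ (i - 1) ≤ b * (W : ℤ) ^ (d - 1) := by
      intro i hi
      have h1 : W ^ (i - 1) ≤ W ^ (d - 1) := Nat.pow_le_pow_right (by omega) (by omega)
      have h2 : W ^ (d - 1) ≤ b * W ^ (d - 1) := Nat.le_mul_of_pos_left _ hb1
      exact_mod_cast h1.trans h2
    have heq : (tricked P ρ W).eval (y : ℤ) - b * (W : ℤ) ^ (d - 1) * (y : ℤ) ^ d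
        = y + ∑ i ∈ Finset.Ico 2 d,
          beta P ρ i * beta P ρ 1 ^ (i - 2) * (W : ℤ) ^ (i - 1) * (y : ℤ) ^ i := by
      rw [eval_tricked, ← hdef, ← Finset.Ico_insert_right hd2,
        Finset.sum_insert Finset.right_notMem_Ico, hb]
      ring
    rw [heq]
    have hnn : (0 : ℤ) ≤ b * (W : ℤ) ^ (d - 1) * (y : ℤ) ^ (d - 1) := by positivity
    have hterm : ∀ i ∈ Finset.Ico 2 d,
        |beta P ρ i * beta P ρ 1 ^ (i - 2) * (W : ℤ) ^ (i - 1) * (y : ℤ) ^ i| ≤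
        ((beta P ρ i * beta P ρ 1 ^ (i - 2)).natAbs : ℤ) *
          (b * (W : ℤ) ^ (d - 1) * (y : ℤ) ^ (d - 1)) := by
      intro i hi
      obtain ⟨hi1, hi2⟩ := Finset.mem_Ico.1 hi
      rw [mul_assoc _ ((W : ℤ) ^ (i - 1)), abs_mul, Int.abs_eq_natAbs (_ * _),
        abs_of_nonneg (by positivity : (0 : ℤ) ≤ (W : ℤ) ^ (i - 1) * (y : ℤ) ^ i)]
      refine mul_le_mul_of_nonneg_left ?_ (by positivity)
      exact mul_le_mul (hWpow i hi2.le) (hpow i (by omega) (by omega)) (by positivity)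
        (by positivity)
    have hy : (y : ℤ) ≤ b * (W : ℤ) ^ (d - 1) * (y : ℤ) ^ (d - 1) := by
      have h1 := hpow 1 le_rfl (by omega)
      rw [pow_one] at h1
      have h2 : (1 : ℤ) ≤ b * (W : ℤ) ^ (d - 1) := by exact_mod_cast hΛ1
      exact h1.trans (le_mul_of_one_le_left (by positivity) h2)
    calc _ ≤ |(y : ℤ)| + ∑ i ∈ Finset.Ico 2 d,
          |beta P ρ i * beta P ρ 1 ^ (i - 2) * (W : ℤ) ^ (i - 1) * (y : ℤ) ^ i| :=
        (abs_add_le _ _).trans (add_le_add le_rfl (Finset.abs_sum_le_sum_abs _ _))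
      _ ≤ b * (W : ℤ) ^ (d - 1) * (y : ℤ) ^ (d - 1) + ∑ i ∈ Finset.Ico 2 d,
          ((beta P ρ i * beta P ρ 1 ^ (i - 2)).natAbs : ℤ) *
            (b * (W : ℤ) ^ (d - 1) * (y : ℤ) ^ (d - 1)) := by
        rw [Nat.abs_cast]
        exact add_le_add hy (Finset.sum_le_sum hterm)
      _ = _ := by
        rw [← Finset.sum_mul, hBz]
        push_cast
        ring
  rw [hlead]
  exact_mod_cast hint

/-! ### The modulus `W` -/

lemma dvd_primorialBelow {w : ℝ} {p : ℕ} (hp : p.Prime) (hpw : (p : ℝ) < w) :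
    p ∣ primorialBelow w :=
  Finset.dvd_prod_of_mem (fun p => p)
    (Finset.mem_filter.2 ⟨Finset.mem_range.2 (Nat.lt_ceil.2 hpw), hp⟩)

lemma primorialBelow_pos (w : ℝ) : 0 < primorialBelow w :=
  Finset.prod_pos fun _ hp => (Finset.mem_filter.1 hp).2.pos

lemma two_le_primorialBelow {w : ℝ} (hw : 10 < w) : 2 ≤ primorialBelow w :=
  Nat.le_of_dvd (primorialBelow_pos w) (dvd_primorialBelow Nat.prime_two (by norm_num; linarith))

/-- Euclid's argument: a prime factor of `W + 1` is at least `w`. -/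
lemma le_primorialBelow_add_one (w : ℝ) : w ≤ primorialBelow w + 1 := by
  by_contra! hlt
  set W := primorialBelow w with hW
  have hW0 : 0 < W := primorialBelow_pos w
  have hp : (W + 1).minFac.Prime := Nat.minFac_prime (by omega)
  have hle : (W + 1).minFac ≤ W + 1 := Nat.minFac_le (by omega)
  have hle' : ((W + 1).minFac : ℝ) ≤ W + 1 := by exact_mod_cast hle
  have h1 : (W + 1).minFac ∣ W := dvd_primorialBelow hp (hle'.trans_lt hlt)
  have h2 : (W + 1).minFac ∣ 1 := (Nat.dvd_add_right h1).1 (Nat.minFac_dvd _)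
  exact hp.one_lt.ne' (Nat.dvd_one.1 h2)

lemma exists_dvd_primorialBelow_pow {w : ℝ} {n : ℕ} (hn : 1 ≤ n) (hnw : (n : ℝ) < w) :
    ∃ J, n ∣ primorialBelow w ^ J := by
  induction n using induction_on_primes with
  | zero => omega
  | one => exact ⟨0, one_dvd _⟩
  | prime_mul p a hp ih =>
    have ha : 1 ≤ a := Nat.pos_of_ne_zero fun h0 => by simp [h0] at hn
    have h1 : (a : ℝ) ≤ ((p * a : ℕ) : ℝ) := by exact_mod_cast Nat.le_mul_of_pos_left a hp.pos
    have h2 : (p : ℝ) ≤ ((p * a : ℕ) : ℝ) := by exact_mod_cast Nat.le_mul_of_pos_right p ha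
    obtain ⟨J, hJ⟩ := ih ha (h1.trans_lt hnw)
    refine ⟨J + 1, ?_⟩
    rw [pow_succ, mul_comm p]
    exact mul_dvd_mul hJ (dvd_primorialBelow hp (h2.trans_lt hnw))

/-! ### Comparison of the two estimates -/

/-- For large `w` the frequency of a large sum would have a denominator composed of primes below
`w`, where the sum is negligible. -/
lemma norm_tsum_lt_of_large {P : ℤ[X]} {ρ : ℤ} {W N B b V r J T K A : ℕ} {w : ℝ}
    (hK : ∀ θ : ℝ, (N : ℝ) / (V * T) ≤ ‖∑' z : ℤ, e (θ * (z : ℝ)) *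
        ((nuStar P ρ W N ((V : ℤ) * z + r) : ℝ) : ℂ)‖ →
      ∃ q : ℕ, 1 ≤ q ∧ q ≤ T ^ K ∧ ∃ a : ℤ,
        |θ - a / (q * (b * W ^ (P.natDegree - 1) * V ^ (P.natDegree - 1)) : ℕ)|
          ≤ (T : ℝ) ^ K * (V / N))
    (h : IsAdapted (tricked P ρ W) W P.natDegree B b) (hN : 1 ≤ N) (hr : r < V)
    (hW : W = primorialBelow w) (hV : V = W ^ J) (hVA : V ≤ W ^ A) (hVN : V ≤ N) (hT : 2 ≤ T)
    (hbw : (b : ℝ) < w) (hTw : (T : ℝ) ≤ w) (hTKw : (T : ℝ) ^ K < w)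
    (hM : (W : ℝ) ^ ((2 * B + 6) + (2 + b + P.natDegree + A * P.natDegree) + 6 + A + 2)
      < scale P ρ W N) (θ : ℝ) :
    ‖∑' z : ℤ, e (θ * (z : ℝ)) * ((nuStar P ρ W N ((V : ℤ) * z + r) : ℝ) : ℂ)‖
      < N / (V * T) := by
  by_contra! hcon
  obtain ⟨q, hq1, hq2, a, ha⟩ := hK θ hcon
  set d := P.natDegree with hd
  have hW2 := h.two_le_W
  have hW2' : (2 : ℝ) ≤ W := by exact_mod_cast hW2
  have hwW : w ≤ (W : ℝ) ^ 2 := by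
    have h1 := le_primorialBelow_add_one w
    rw [← hW] at h1
    nlinarith
  have hqw : (q : ℝ) < w := by
    have : (q : ℝ) ≤ (T : ℝ) ^ K := by exact_mod_cast hq2
    linarith
  have hscale := scale_pos h hN
  have hN0 : (0 : ℝ) < N := by exact_mod_cast hN
  have hV0 : 0 < V := by omega
  have hV0' : (0 : ℝ) < V := by exact_mod_cast hV0
  have hT0 : (0 : ℝ) < T := by exact_mod_cast (by omega : 0 < T)
  obtain ⟨J₁, hJ₁⟩ := exists_dvd_primorialBelow_pow hq1 hqw
  obtain ⟨J₂, hJ₂⟩ := exists_dvd_primorialBelow_pow h.one_le_b hbw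
  rw [← hW] at hJ₁ hJ₂
  set D := q * (b * W ^ (d - 1) * V ^ (d - 1)) with hD
  have hD1 : 1 ≤ D := by
    have := h.one_le_b
    have : 0 < W := by omega
    exact Nat.mul_pos hq1 (by positivity)
  have hVD : V * D ∣ W ^ (J + (J₁ + (J₂ + (d - 1) + J * (d - 1)))) := by
    rw [pow_add, pow_add, pow_add, pow_add, pow_mul, ← hV, hD]
    exact mul_dvd_mul dvd_rfl (mul_dvd_mul hJ₁ (mul_dvd_mul (mul_dvd_mul hJ₂ dvd_rfl) dvd_rfl))
  have hbound := norm_tsum_le_of_smooth_denominator h hN hr hVN hD1 hVD ha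
  -- all the losses are bounded by a power of `W`
  have hBW : (2 * (B : ℝ) + 6) ≤ (W : ℝ) ^ (2 * B + 6) := by
    have h1 : 2 * B + 6 ≤ W ^ (2 * B + 6) :=
      (Nat.lt_two_pow_self (n := 2 * B + 6)).le.trans (Nat.pow_le_pow_left hW2 _)
    exact_mod_cast h1
  have hDW : (D : ℝ) ≤ (W : ℝ) ^ (2 + b + d + A * d) := by
    have hbW : b ≤ W ^ b := (Nat.lt_two_pow_self (n := b)).le.trans (Nat.pow_le_pow_left hW2 _)
    have hqW : q ≤ W ^ 2 := by exact_mod_cast (hqw.le.trans hwW : (q : ℝ) ≤ (W : ℝ) ^ 2)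
    have hWd : W ^ (d - 1) ≤ W ^ d := Nat.pow_le_pow_right (by omega) (by omega)
    have hVd : V ^ (d - 1) ≤ W ^ (A * d) := by
      calc V ^ (d - 1) ≤ V ^ d := Nat.pow_le_pow_right hV0 (by omega)
        _ ≤ (W ^ A) ^ d := Nat.pow_le_pow_left hVA d
        _ = _ := by rw [← pow_mul]
    have : D ≤ W ^ (2 + b + d + A * d) := by
      calc D ≤ W ^ 2 * (W ^ b * W ^ d * W ^ (A * d)) :=
            Nat.mul_le_mul hqW (Nat.mul_le_mul (Nat.mul_le_mul hbW hWd) hVd)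
        _ = _ := by ring
    exact_mod_cast this
  have hHW : 2 + 13 * (T : ℝ) ^ K ≤ (W : ℝ) ^ 6 := by
    have h1 : (T : ℝ) ^ K ≤ (W : ℝ) ^ 2 := hTKw.le.trans hwW
    have h2 : (4 : ℝ) ≤ (W : ℝ) ^ 2 := by nlinarith
    have h3 : (16 : ℝ) ≤ (W : ℝ) ^ 4 := by
      calc (16 : ℝ) = 2 ^ 4 := by norm_num
        _ ≤ _ := by gcongr
    calc 2 + 13 * (T : ℝ) ^ K ≤ 16 * (W : ℝ) ^ 2 := by linarith
      _ ≤ (W : ℝ) ^ 4 * (W : ℝ) ^ 2 := by gcongr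
      _ = _ := by ring
  have hVW : (V : ℝ) ≤ (W : ℝ) ^ A := by exact_mod_cast hVA
  have hTW : (T : ℝ) ≤ (W : ℝ) ^ 2 := hTw.trans hwW
  have hprod : (2 * (B : ℝ) + 6) * D * (2 + 13 * (T : ℝ) ^ K) * V * T < scale P ρ W N := by
    refine lt_of_le_of_lt ?_ hM
    rw [pow_add, pow_add, pow_add, pow_add]
    gcongr
  have hlt : (2 * B + 6) * (N / scale P ρ W N) * (D * (2 + 13 * (T : ℝ) ^ K)) < N / (V * T) := by
    rw [lt_div_iff₀ (by positivity)]
    calc (2 * B + 6) * (N / scale P ρ W N) * (D * (2 + 13 * (T : ℝ) ^ K)) * (V * T)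
        = N * ((2 * (B : ℝ) + 6) * D * (2 + 13 * (T : ℝ) ^ K) * V * T / scale P ρ W N) := by ring
      _ < N * 1 := by
        refine mul_lt_mul_of_pos_left ?_ hN0
        rwa [div_lt_one hscale]
      _ = N := mul_one _
  linarith

end NuUniformity

theorem propositionF1 (P : Polynomial ℤ) (ρ : ℤ)
    (hρ : P.rootMultiplicity ρ = 1)
    (hpos : 0 < P.leadingCoeff * NuUniformity.beta P ρ 1 ^ P.natDegree)
    (C₁ : ℝ) (hC₁ : 0 < C₁) :
    ∃ C₂ c K : ℝ, 0 < C₂ ∧ 0 < c ∧ 0 < K ∧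
      ∀ (w : ℝ) (W V N k : ℕ), 10 < w → W = NuUniformity.primorialBelow w →
        V = W ^ k → (V : ℝ) ≤ (W : ℝ) ^ C₁ → (W : ℝ) ^ C₂ ≤ (N : ℝ) →
        ∀ r : ℤ, r ∈ NuUniformity.interval (V : ℝ) → ∀ θ : ℝ,
          ‖∑' z : ℤ, NuUniformity.e (θ * (z : ℝ)) *
              ((NuUniformity.nuStar P ρ W N ((V : ℤ) * z + r) : ℝ) : ℂ)‖
            ≤ K * ((N : ℝ) / ((V : ℝ) * w ^ c)) := by
  open NuUniformity in
  have hd := one_le_natDegree_of_rootMultiplicity hρ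
  obtain ⟨B, b, hadapted⟩ := exists_isAdapted_tricked P ρ hρ hpos
  obtain ⟨K, hK⟩ := exists_denominator_of_large_tsum hd
  set d := P.natDegree with hdef
  set A := ⌈C₁⌉₊ with hA
  -- all losses together are at most `W ^ E`
  set E := (2 * B + 6) + (2 + b + d + A * d) + 6 + A + 2 with hE
  -- with this exponent, `T = ⌊w ^ c⌋` satisfies `T ^ K < w`
  set c : ℝ := 1 / ((K : ℝ) + 1) with hc
  have hc0 : 0 < c := by positivity
  set w₀ : ℝ := max (2 ^ (K + 1)) (b + 1) with hw₀
  have hw₀0 : 0 < w₀ := lt_max_of_lt_left (by positivity)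
  refine ⟨((b + d + (E + 1) * d : ℕ) : ℝ), c, 5 * w₀ ^ c + 2, ?_, hc0, by positivity, ?_⟩
  · exact_mod_cast (by omega : 0 < b + d + (E + 1) * d)
  intro w W V N k hw hW hV hVC hNC r hr θ
  have hW2 : 2 ≤ W := hW ▸ two_le_primorialBelow hw
  have hW2' : (2 : ℝ) ≤ W := by exact_mod_cast hW2
  have hW1' : (1 : ℝ) ≤ W := by linarith
  have h := hadapted W hW2
  have hw0 : 0 < w := by linarith
  have hwc0 : 0 < w ^ c := Real.rpow_pos_of_pos hw0 c
  rw [Real.rpow_natCast] at hNC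
  have hN1 : 1 ≤ N := by
    have h1 : (1 : ℝ) ≤ N := (one_le_pow₀ hW1').trans hNC
    exact_mod_cast h1
  have hN0 : (0 : ℝ) < N := by exact_mod_cast hN1
  have hVA : V ≤ W ^ A := by
    have h1 : (V : ℝ) ≤ (W : ℝ) ^ (A : ℝ) :=
      hVC.trans (Real.rpow_le_rpow_of_exponent_le hW1' (Nat.le_ceil C₁))
    rw [Real.rpow_natCast] at h1
    exact_mod_cast h1
  have hVA' : (V : ℝ) ≤ (W : ℝ) ^ A := by exact_mod_cast hVA
  have hV1 : 1 ≤ V := hV ▸ Nat.one_le_pow _ _ (by omega)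
  have hV0 : (0 : ℝ) < V := by exact_mod_cast hV1
  obtain ⟨r, hrV, rfl⟩ := (mem_interval_iff (Nat.cast_nonneg V) r).1 hr
  rw [Nat.floor_natCast] at hrV
  -- the length of the polynomial progression exceeds a large power of `W`
  have hM0 := scale_pos h hN1
  have hM : (W : ℝ) ^ (E + 1) ≤ scale P ρ W N := by
    have h1 := leadingCoeff_mul_scale_pow (N := N) h
    have hbW : (b : ℝ) ≤ (W : ℝ) ^ b := by
      exact_mod_cast (Nat.lt_two_pow_self (n := b)).le.trans (Nat.pow_le_pow_left hW2 _)
    have hΛ : ((tricked P ρ W).leadingCoeff : ℝ) ≤ (W : ℝ) ^ (b + d) := by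
      rw [h.leadingCoeff_eq, pow_add]
      push_cast
      gcongr
      omega
    have h2 : (W : ℝ) ^ (b + d) * ((W : ℝ) ^ (E + 1)) ^ d
        ≤ (W : ℝ) ^ (b + d) * scale P ρ W N ^ d := by
      calc _ = (W : ℝ) ^ (b + d + (E + 1) * d) := by rw [← pow_mul, ← pow_add]
        _ ≤ N := hNC
        _ = (tricked P ρ W).leadingCoeff * scale P ρ W N ^ d := h1.symm
        _ ≤ _ := by gcongr
    have h3 := le_of_mul_le_mul_left h2 (by positivity)
    exact le_of_pow_le_pow_left₀ (by omega) hM0.le h3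
  have hVM : (V : ℝ) ≤ scale P ρ W N :=
    hVA'.trans ((pow_le_pow_right₀ hW1' (by omega)).trans hM)
  have hVN : V ≤ N := by
    have h1 : A ≤ (E + 1) * d := (by omega : A ≤ E + 1).trans (Nat.le_mul_of_pos_right _ hd)
    have h2 : (V : ℝ) ≤ N := hVA'.trans ((pow_le_pow_right₀ hW1' (by omega)).trans hNC)
    exact_mod_cast h2
  have hVW : V ∣ W ^ k := hV ▸ dvd_rfl
  rcases lt_or_ge w w₀ with hsmall | hlarge
  · refine (norm_tsum_le_trivial h hN1 hrV hVW hVM θ).trans ?_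
    have h1 : w ^ c ≤ w₀ ^ c := Real.rpow_le_rpow hw0.le hsmall.le hc0.le
    rw [← div_div, ← mul_div_assoc (5 * w₀ ^ c + 2), le_div_iff₀ hwc0]
    have h2 : 0 ≤ (N : ℝ) / V := by positivity
    nlinarith [mul_le_mul_of_nonneg_left h1 h2]
  have hwK : (2 : ℝ) ^ (K + 1) ≤ w := (le_max_left _ _).trans hlarge
  have hbw : (b : ℝ) < w := by
    have : (b : ℝ) + 1 ≤ w := (le_max_right _ _).trans hlarge
    linarith
  have hwcK : (w ^ c) ^ (K + 1) = w := by
    rw [hc, ← Nat.cast_add_one, one_div, Real.rpow_inv_natCast_pow hw0.le (by omega)]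
  have hwc2 : (2 : ℝ) ≤ w ^ c := by
    refine le_of_pow_le_pow_left₀ (n := K + 1) (by omega) hwc0.le ?_
    rwa [hwcK]
  set T := ⌊w ^ c⌋₊ with hTdef
  have hT2 : 2 ≤ T := Nat.le_floor (by exact_mod_cast hwc2)
  have hTle : (T : ℝ) ≤ w ^ c := Nat.floor_le hwc0.le
  have hTge : w ^ c < T + 1 := Nat.lt_floor_add_one _
  have hT0 : (0 : ℝ) < T := by exact_mod_cast (by omega : 0 < T)
  have hwcw : w ^ c ≤ w := by
    conv_rhs => rw [← hwcK]
    exact le_self_pow₀ (by linarith) (by omega)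
  have hTK : (T : ℝ) ^ K < w := by
    calc (T : ℝ) ^ K ≤ (w ^ c) ^ K := by gcongr
      _ < (w ^ c) ^ (K + 1) := pow_lt_pow_right₀ (by linarith) (by omega)
      _ = w := hwcK
  have hTV : 16 * (T : ℝ) * V ≤ scale P ρ W N := by
    have h1 : (T : ℝ) ≤ (W : ℝ) ^ 2 := by
      have h2 := le_primorialBelow_add_one w
      rw [← hW] at h2
      nlinarith
    have h2 : (16 : ℝ) ≤ (W : ℝ) ^ 4 := by
      calc (16 : ℝ) = 2 ^ 4 := by norm_num
        _ ≤ _ := by gcongr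
    calc 16 * (T : ℝ) * V ≤ (W : ℝ) ^ 4 * (W : ℝ) ^ 2 * (W : ℝ) ^ A := by gcongr
      _ = (W : ℝ) ^ (6 + A) := by ring
      _ ≤ (W : ℝ) ^ (E + 1) := pow_le_pow_right₀ hW1' (by omega)
      _ ≤ _ := hM
  have hmain := norm_tsum_lt_of_large (K := K)
    (fun θ => hK rfl h hN1 hrV hVW hT2 hTV θ) h hN1 hrV hW hV hVA hVN hT2 hbw (hTle.trans hwcw)
    hTK ((pow_lt_pow_right₀ (by linarith) (Nat.lt_succ_self E)).trans_le hM) θ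
  refine hmain.le.trans ?_
  have h1 : (N : ℝ) / (V * T) ≤ 2 * (N / (V * w ^ c)) := by
    rw [div_le_iff₀ (by positivity)]
    have h2 : w ^ c ≤ 2 * T := by linarith
    calc (N : ℝ) = N / w ^ c * w ^ c := by field_simp
      _ ≤ N / w ^ c * (2 * T) := by gcongr
      _ = _ := by field_simp
  refine h1.trans (mul_le_mul_of_nonneg_right ?_ (by positivity))
  have : 0 < w₀ ^ c := by positivity
  linarith
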